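/- **Setting.** Let $d\ge 1$, $\mathcal A$ a finite action set, $\mathcal X$ a context set, $\nu$ a probability distribution on $\mathcal X$, $r:\mathcal X\times\mathcal A\to[0,1]$, $c:\mathcal X\times\mathcal A\to[-1,1]^d$ unknown functions, $T\ge 1$, $B\in[0,1]^d$. At each round $t=1,\dots,T$ a context $x_t\sim\nu$ is drawn independently of the past, the learner picks $a_t\in\mathcal A$, and gets a reward $r_t\in[0,1]$ and costs $c_t\in[-1,1]^d$ whose conditional expectations given the past, $x_t$ and $a_t$ are $r(x_t,a_t)$ and $c(x_t,a_t)$. Inequalities between vectors are coordinatewise, $(\cdot)_+$ is the coordinatewise positive part, $\|\cdot\|$ the Euclidean norm, $\mathbf 1=(1,\dots,1)$. The problem $(r,c,B',\nu)$ is feasible if some policy $\pi:\mathcal X\to\mathcal P(\mathcal A)$ satisfies $\mathbb E_{X\sim\nu}\bigl[\sum_a c(X,a)\pi_a(X)\bigr]\le B'$; $\mathrm{opt}(r,c,B')$ is the supremum of $\mathbb E_{X\sim\nu}\bigl[\sum_a r(X,a)\pi_a(X)\bigr]$ over these policies. The regret is $R_T=T\,\mathrm{opt}(r,c,B)-\sum_{t\le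 T}r_t$. Denote by $\lambda^\star_{B'}$ any minimizer over $\lambda\ge 0$ of $\lambda\mapsto\mathbb E_{X\sim\nu}\bigl[\max_a\{r(X,a)-\langle c(X,a)-B',\lambda\rangle\}\bigr]$. **Uniform estimation assumption.** Estimates $\hat r_t:\mathcal X\times\mathcal A\to[0,1]$, $\hat c_t:\mathcal X\times\mathcal A\to[-1,1]^d$ are computed from $(x_s,a_s,r_s,c_s)_{s\le t}$ and known error functions $\epsilon_t:\mathcal X\times\mathcal A\times(0,1]\to[0,1]$ from $(x_s,a_s)_{s\le t}$, such that for all $\delta\in(0,1]$, with probability at least $1-\delta$, $|\hat r_t(x,a)-r(x,a)|\le\epsilon_t(x,a,\delta)$ and $|\hat c_t(x,a)-c(x,a)|\le\epsilon_t(x,a,\delta)\mathbf 1$ for all $0\le t\le T$, $x$, $a$. Moreover, for all sequences of contexts and actions, $\sum_{t=1}^T\epsilon_{t-1}(x_t,a_t,\delta)\le\beta_{T,\delta}$, where the known quantity $\beta_{T,\delta}$ is non-increasing in $\delta$ and $\beta_{T,\delta}\le C_\beta\sqrt T\ln(T/\delta)$. **Meta-strategy.** Let $\mathrm{clip}[y]_\ell^u=\min\{\max\{y,\ell\},u\}$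 (coordinatewise for vectors), $\hat r^{\mathrm{ucb}}_{\delta,t}=\mathrm{clip}[\hat r_t+\epsilon_t(\cdot,\delta)]_0^1$, $\hat c^{\,\mathrm{lcb}}_{\delta,t}=\mathrm{clip}[\hat c_t-\epsilon_t(\cdot,\delta)\mathbf 1]_{-1}^1$, $\mathrm{ilog}\,T=\lceil\log_2T\rceil$, $$\Upsilon_{T,\delta}=\max\Bigl\{\beta_{T,\delta/4},\ 2\sqrt{dT\ln\tfrac{T^2}{\delta/4}},\ \sqrt{2T\ln\tfrac{2(d+1)T}{\delta/4}}\Bigr\},\qquad M_{T,\delta,k}=4\sqrt T+20\sqrt d\,\Upsilon_{T,\delta/(k+2)^2},$$ $\gamma_k=2^k/\sqrt T$, $\delta_k=\delta/(4(k+2)^2)$, and $b_T=(1+\mathrm{ilog}\,T)\bigl(M_{T,\delta,\mathrm{ilog}\,T}+2\sqrt d\bigr)/T$. The strategy runs through regimes $k=0,1,2,\dots$; regime $k$ starts at round $T_k$ (with $T_0=1$), with $\lambda_{T_k-1}=0$. In each round $t\ge T_k$ of regime $k$ it picks $a_t$ maximizing $\hat r^{\mathrm{ucb}}_{\delta_k,t-1}(x_t,a)-\langle\hat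 c^{\,\mathrm{lcb}}_{\delta_k,t-1}(x_t,a)-(B-b_T\mathbf 1),\lambda_{t-1}\rangle$ over $a$, and then updates $\lambda_t=\bigl(\lambda_{t-1}+\gamma_k(\hat c^{\,\mathrm{lcb}}_{\delta_k,t-1}(x_t,a_t)-(B-b_T\mathbf 1))\bigr)_+$. As soon as $\bigl\|\bigl(\sum_{\tau=T_k}^tc_\tau-(t-T_k+1)(B-b_T\mathbf 1)\bigr)_+\bigr\|>M_{T,\delta,k}$, regime $k$ stops and $T_{k+1}=t+1$. **Theorem.** There are constants $C,p$, depending only on $d$ and $C_\beta$, such that the following holds. Let $\delta\in(0,1)$ and let the uniform estimation assumption hold along the interaction with the meta-strategy above. Then $b_T\le C\,(1+\ln(T/\delta))^p/\sqrt T$, that is, $b_T=\widetilde{\mathcal O}(1/\sqrt T)$. If moreover $B\ge2b_T\mathbf 1$ and the problem $(r,c,B-2b_T\mathbf 1,\nu)$ is feasible, then $\lambda^\star_{B-b_T\mathbf 1}$ exists and, for every choice of it, with probability at least $1-\delta$, all of the following hold: $$\sum_{t\le T}c_t\le TB,$$ $$R_T\le 36\sqrt d\,\max\bigl\{1,4\|\lambda^\star_{B-b_T\mathbf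 1}\|\bigr\}\frac{\bigl(\Upsilon_{T,\delta/(2+\mathrm{ilog}\,T)^2}\bigr)^2}{\sqrt T}+\|\lambda^\star_{B-b_T\mathbf 1}\|\Bigl(T\,b_T\sqrt d+6\,\Upsilon_{T,\delta/(2+\mathrm{ilog}\,T)^2}\,\mathrm{ilog}\,T\Bigr)+8\ln\frac{T^2}{\delta/(4(2+\mathrm{ilog}\,T)^2)}\,\mathrm{ilog}\,T,$$ $$R_T\le C\,\bigl(1+\|\lambda^\star_{B-b_T\mathbf 1}\|\bigr)\sqrt T\,\bigl(1+\ln(T/\delta)\bigr)^p,\qquad\text{that is, } R_T\le\widetilde{\mathcal O}\bigl((1+\|\lambda^\star_{B-b_T\mathbf 1}\|)\sqrt T\bigr).$$ -/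

import Mathlib

open MeasureTheory ProbabilityTheory

noncomputable section

namespace CBwK

/-! Vectors of `ℝ^d` are functions `Fin d → ℝ`, with the coordinatewise order `≤` and positive part
`v⁺`; rounds are numbered `0, …, T - 1`, so that the estimates used in round `t` rely on the `t`
observations of the rounds `s < t`. -/

/-- Euclidean norm on `ℝ^d`. -/
def norm₂ {d : ℕ} (v : Fin d → ℝ) : ℝ := ‖WithLp.toLp 2 v‖

/-- The vector `B - b 𝟏`. -/
def shift {d : ℕ} (B : Fin d → ℝ) (b : ℝ) : Fin d → ℝ := fun i => B i - b

/-- `clip[y]_l^u = min (max y l) u`. -/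
def clip (l u y : ℝ) : ℝ := min (max y l) u

/-- `ilog T = ⌈log₂ T⌉`. -/
def ilog (T : ℕ) : ℕ := ⌈Real.logb 2 T⌉₊

section Problem

variable {X A : Type*} [MeasurableSpace X] [Fintype A] {d : ℕ}

/-- The unknown parameters of a contextual bandit problem with knapsacks: the distribution of the
contexts, the expected-reward function and the (signed, vector-valued) expected-cost function. -/
structure Problem (X A : Type*) [MeasurableSpace X] (d : ℕ) where
  ν : Measure X
  prob : IsProbabilityMeasure ν
  r : X → A → ℝ
  c : X → A → Fin d → ℝ
  r_meas : ∀ a, Measurable fun x => r x a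
  c_meas : ∀ a, Measurable fun x => c x a
  r_mem : ∀ x a, r x a ∈ Set.Icc (0 : ℝ) 1
  c_mem : ∀ x a i, c x a i ∈ Set.Icc (-1 : ℝ) 1

/-- A static policy: a (measurable) map from contexts to probability distributions on actions. -/
structure IsPolicy (π : X → A → ℝ) : Prop where
  meas : ∀ a, Measurable fun x => π x a
  nonneg : ∀ x a, 0 ≤ π x a
  sum_eq_one : ∀ x, ∑ a, π x a = 1

namespace Problem

/-- Expected reward of a static policy. -/
def reward (P : Problem X A d) (π : X → A → ℝ) : ℝ := ∫ x, ∑ a, P.r x a * π x a ∂P.ν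

/-- Expected cost vector of a static policy. -/
def cost (P : Problem X A d) (π : X → A → ℝ) : Fin d → ℝ :=
  fun i => ∫ x, ∑ a, P.c x a i * π x a ∂P.ν

/-- Feasibility of the problem with average cost constraints `B`. -/
def Feasible (P : Problem X A d) (B : Fin d → ℝ) : Prop :=
  ∃ π : X → A → ℝ, IsPolicy π ∧ P.cost π ≤ B

/-- The optimal expected reward of a static policy under the average cost constraints `B`. -/
def opt (P : Problem X A d) (B : Fin d → ℝ) : ℝ :=
  sSup {v | ∃ π : X → A → ℝ, IsPolicy π ∧ P.cost π ≤ B ∧ v = P.reward π}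

/-- The dual objective `λ ↦ 𝔼_{x ∼ ν}[max_a {r(x,a) - ⟨c(x,a) - B, λ⟩}]`. -/
def dual (P : Problem X A d) (B lam : Fin d → ℝ) : ℝ :=
  ∫ x, ⨆ a, (P.r x a - (P.c x a - B) ⬝ᵥ lam) ∂P.ν

/-- `lam` is an optimal dual variable `λ*_B`: it minimizes the dual objective over `λ ≥ 0`. -/
def IsDualOptimal (P : Problem X A d) (B lam : Fin d → ℝ) : Prop :=
  0 ≤ lam ∧ ∀ lam' : Fin d → ℝ, 0 ≤ lam' → P.dual B lam ≤ P.dual B lam'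

end Problem

end Problem

section Estimation

/-- What is observed in one round: context, action, reward, cost vector. -/
abbrev Obs (X A : Type*) (d : ℕ) := X × A × ℝ × (Fin d → ℝ)

/-- An estimation procedure: estimates `r̂_t`, `ĉ_t` computed from the first `t` observations, and
error functions `ε_t(x, a, δ)` computed from the first `t` context-action pairs. -/
structure Estimator (X A : Type*) [MeasurableSpace X] [MeasurableSpace A] (d : ℕ) where
  rHat : (t : ℕ) → (Fin t → Obs X A d) → X → A → ℝ
  cHat : (t : ℕ) → (Fin t → Obs X A d) → X → A → Fin d → ℝ
  err : (t : ℕ) → (Fin t → X × A) → X → A → ℝ → ℝ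
  rHat_meas : ∀ t, Measurable fun q : (Fin t → Obs X A d) × X × A => rHat t q.1 q.2.1 q.2.2
  cHat_meas : ∀ t, Measurable fun q : (Fin t → Obs X A d) × X × A => cHat t q.1 q.2.1 q.2.2
  err_meas : ∀ t δ, Measurable fun q : (Fin t → X × A) × X × A => err t q.1 q.2.1 q.2.2 δ
  rHat_mem : ∀ t h x a, rHat t h x a ∈ Set.Icc (0 : ℝ) 1
  cHat_mem : ∀ t h x a i, cHat t h x a i ∈ Set.Icc (-1 : ℝ) 1
  err_mem : ∀ t h x a, ∀ δ ∈ Set.Ioc (0 : ℝ) 1, err t h x a δ ∈ Set.Icc (0 : ℝ) 1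

namespace Estimator

variable {X A : Type*} [MeasurableSpace X] [MeasurableSpace A] {d : ℕ}

/-- `ε_t(x, a, δ)` along a history of observations. -/
def errObs (E : Estimator X A d) (t : ℕ) (h : Fin t → Obs X A d) (x : X) (a : A) (δ : ℝ) : ℝ :=
  E.err t (fun s => ((h s).1, (h s).2.1)) x a δ

/-- Clipped upper-confidence estimate of the expected rewards. -/
def rUcb (E : Estimator X A d) (δ : ℝ) (t : ℕ) (h : Fin t → Obs X A d) (x : X) (a : A) : ℝ :=
  clip 0 1 (E.rHat t h x a + E.errObs t h x a δ)

/-- Clipped lower-confidence estimate of the expected costs. -/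
def cLcb (E : Estimator X A d) (δ : ℝ) (t : ℕ) (h : Fin t → Obs X A d) (x : X) (a : A) :
    Fin d → ℝ :=
  fun i => clip (-1) 1 (E.cHat t h x a i - E.errObs t h x a δ)

end Estimator

end Estimation

section Constants

variable (d T : ℕ) (β : ℝ → ℝ)

/-- `Υ_{T,δ}`, where `β δ` stands for `β_{T,δ}`. -/
def Upsilon (δ : ℝ) : ℝ :=
  max (β (δ / 4))
    (max (2 * √(d * T * Real.log ((T : ℝ) ^ 2 / (δ / 4))))
      (√(2 * T * Real.log (2 * (d + 1) * T / (δ / 4)))))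

/-- The cost-deviation threshold `M_{T,δ,k}` of regime `k`. -/
def threshold (δ : ℝ) (k : ℕ) : ℝ :=
  4 * √T + 20 * √d * Upsilon d T β (δ / ((k : ℝ) + 2) ^ 2)

/-- The margin `b_T`. -/
def margin (δ : ℝ) : ℝ :=
  (1 + (ilog T : ℝ)) * (threshold d T β δ (ilog T) + 2 * √d) / T

/-- The step size `γ_k = 2^k / √T` of regime `k`. -/
def stepSize (k : ℕ) : ℝ := 2 ^ k / √T

/-- The risk level `δ / (4 (k+2)²)` of regime `k`. -/
def riskLevel (δ : ℝ) (k : ℕ) : ℝ := δ / (4 * ((k : ℝ) + 2) ^ 2)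

end Constants

section Strategy

variable {X A : Type*} [MeasurableSpace X] [MeasurableSpace A] {d : ℕ}

/-- Internal state of the meta-strategy at the beginning of a round: index `k` of the current
regime, its first round, and the current dual variable. -/
structure State (d : ℕ) where
  regime : ℕ
  start : ℕ
  lam : Fin d → ℝ

/-- The first `t` terms of a sequence of observations. -/
def hist (o : ℕ → Obs X A d) (t : ℕ) : Fin t → Obs X A d := fun s => o s

/-- State of the meta-strategy with margin `b` at the beginning of round `t`, as a function of the
observations of the rounds `s < t`. After round `t`, the dual variable undergoes a projected
gradient step with the step size and the risk level of the current regime, except if the costs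
accumulated over this regime exceed `B - b 𝟏` per round by more than the threshold: then the next
regime starts at round `t + 1` with a null dual variable. -/
def state (E : Estimator X A d) (T : ℕ) (β : ℝ → ℝ) (δ : ℝ) (B : Fin d → ℝ) (b : ℝ)
    (o : ℕ → Obs X A d) : ℕ → State d
  | 0 => ⟨0, 0, 0⟩
  | t + 1 =>
    let S := state E T β δ B b o t
    let dev : Fin d → ℝ :=
      (∑ τ ∈ Finset.Ico S.start (t + 1), (o τ).2.2.2) - ((t + 1 - S.start : ℕ) : ℝ) • shift B b
    if threshold d T β δ S.regime < norm₂ dev⁺ then ⟨S.regime + 1, t + 1, 0⟩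
    else ⟨S.regime, S.start,
      (S.lam + stepSize T S.regime •
        (E.cLcb (riskLevel δ S.regime) t (hist o t) (o t).1 (o t).2.1 - shift B b))⁺⟩

/-- The quantity maximized over the actions `a'` in round `t`, when `o` is the sequence of
observations and `x` the context of round `t`. -/
def score (E : Estimator X A d) (T : ℕ) (β : ℝ → ℝ) (δ : ℝ) (B : Fin d → ℝ) (b : ℝ)
    (o : ℕ → Obs X A d) (t : ℕ) (x : X) (a' : A) : ℝ :=
  let S := state E T β δ B b o t
  E.rUcb (riskLevel δ S.regime) t (hist o t) x a' -
    (E.cLcb (riskLevel δ S.regime) t (hist o t) x a' - shift B b) ⬝ᵥ S.lam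

/-- The actions of the sequence of observations `o` are picked by the meta-strategy in all rounds
(ties being broken in an arbitrary way). -/
def FollowsMeta (E : Estimator X A d) (T : ℕ) (β : ℝ → ℝ) (δ : ℝ) (B : Fin d → ℝ) (b : ℝ)
    (o : ℕ → Obs X A d) : Prop :=
  ∀ t < T, ∀ a' : A,
    score E T β δ B b o t (o t).1 a' ≤ score E T β δ B b o t (o t).1 (o t).2.1

end Strategy

section Interaction

variable {Ω X A : Type*} [MeasurableSpace Ω] [MeasurableSpace X] [MeasurableSpace A] {d : ℕ}

/-- σ-algebra generated by the observations of the rounds `s < t`. -/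
@[reducible] def pastSigma (o : ℕ → Ω → Obs X A d) (t : ℕ) : MeasurableSpace Ω :=
  ⨆ s, ⨆ _ : s < t, MeasurableSpace.comap (o s) inferInstance

/-- σ-algebra generated by the past, the context and the action of round `t`. -/
@[reducible] def playSigma (o : ℕ → Ω → Obs X A d) (t : ℕ) : MeasurableSpace Ω :=
  pastSigma o t ⊔ MeasurableSpace.comap (fun ω => ((o t ω).1, (o t ω).2.1)) inferInstance

/-- The interaction protocol over `T` rounds: contexts are drawn from `ν` independently of the past;
rewards and costs lie in `[0,1]` and `[-1,1]^d`, and their conditional expectations given the past,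
the context and the action are `r(x_t,a_t)` and `c(x_t,a_t)`. -/
structure IsInteraction (P : Problem X A d) (μ : Measure Ω) (T : ℕ) (o : ℕ → Ω → Obs X A d) :
    Prop where
  meas : ∀ t, Measurable (o t)
  law : ∀ t < T, μ.map (fun ω => (o t ω).1) = P.ν
  indep : ∀ t < T,
    Indep (pastSigma o t) (MeasurableSpace.comap (fun ω => (o t ω).1) inferInstance) μ
  reward_mem : ∀ t < T, ∀ ω, (o t ω).2.2.1 ∈ Set.Icc (0 : ℝ) 1
  cost_mem : ∀ t < T, ∀ ω i, (o t ω).2.2.2 i ∈ Set.Icc (-1 : ℝ) 1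
  reward_condExp : ∀ t < T,
    μ[fun ω => (o t ω).2.2.1 | playSigma o t] =ᵐ[μ] fun ω => P.r (o t ω).1 (o t ω).2.1
  cost_condExp : ∀ t < T, ∀ i,
    μ[fun ω => (o t ω).2.2.2 i | playSigma o t] =ᵐ[μ] fun ω => P.c (o t ω).1 (o t ω).2.1 i

/-- Uniform estimation: with probability at least `1 - δ` the errors of all estimates are controlled
by the error functions, uniformly in time, contexts and actions; and, for all sequences of contexts
and actions, the sum of the errors at the pairs played is at most `β_{T,δ}`, a known quantity that
does not decrease as the risk `δ` gets smaller and is at most `Cβ √T ln(T/δ)`.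
The probabilistic guarantee is only required for the interaction `o` at hand. -/
structure UniformEstimation (P : Problem X A d) (E : Estimator X A d) (μ : Measure Ω) (T : ℕ)
    (o : ℕ → Ω → Obs X A d) (β : ℝ → ℝ) (Cβ : ℝ) : Prop where
  accurate : ∀ δ ∈ Set.Ioc (0 : ℝ) 1,
    μ {ω | ¬ ∀ t ≤ T, ∀ (x : X) (a : A),
      |E.rHat t (hist (fun s => o s ω) t) x a - P.r x a|
          ≤ E.errObs t (hist (fun s => o s ω) t) x a δ ∧
        ∀ i, |E.cHat t (hist (fun s => o s ω) t) x a i - P.c x a i|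
          ≤ E.errObs t (hist (fun s => o s ω) t) x a δ} ≤ ENNReal.ofReal δ
  budget : ∀ δ ∈ Set.Ioc (0 : ℝ) 1, ∀ (x : ℕ → X) (a : ℕ → A),
    ∑ t ∈ Finset.range T, E.err t (fun s => (x s, a s)) (x t) (a t) δ ≤ β δ
  antitone : AntitoneOn β (Set.Ioc 0 1)
  rate : ∀ δ ∈ Set.Ioc (0 : ℝ) 1, β δ ≤ Cβ * √T * Real.log (T / δ)

/-- The regret `R_T = T opt(r,c,B) - ∑_t r_t`. -/
def regret [Fintype A] (P : Problem X A d) (B : Fin d → ℝ) (T : ℕ) (o : ℕ → Obs X A d) : ℝ :=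
  T * P.opt B - ∑ t ∈ Finset.range T, (o t).2.2.1

end Interaction

/-- The closed-form regret bound, where `n` is the Euclidean norm of the optimal dual variable. -/
def regretBound (d T : ℕ) (β : ℝ → ℝ) (δ n : ℝ) : ℝ :=
  let U := Upsilon d T β (δ / (2 + (ilog T : ℝ)) ^ 2)
  36 * max 1 (4 * n) * √d * (U ^ 2 / √T)
    + n * (T * margin d T β δ * √d + 6 * U * ilog T)
    + 8 * Real.log ((T : ℝ) ^ 2 / (δ / (4 * (2 + (ilog T : ℝ)) ^ 2))) * ilog T

end CBwK

end

/-! Within one regime the strategy runs projected gradient descent on the dual objective of the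
problem with budget `B - b`, each gradient being an optimistic cost minus that budget. Only weak
duality is needed: `Problem.opt_le_dual_shift_add` bounds the optimal value by the dual objective at
any `λ ≥ 0`, plus `b √d ‖λ‖` for the tightened budget. Feasibility at `B - 2b` leaves slack `b` at
level `B - b`, which makes the dual objective coercive. So a minimizer `v` exists, and `‖v‖ ≤ 1/b ≤
T ≤ 2 ^ ilog T`. Hence some regime `K ≤ ilog T` satisfies `‖v‖ ≤ 2 ^ K`. For the first such `K`, the
step sizes up to `K` sum to at most `max 1 (4‖v‖) / √T`.

The core is that in each regime `k ≤ K` the iterates stay in a ball around `v` of radius `R_k = ‖v‖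
+ 7 √d γ_k Υ_k`. Optimism gives an approximate subgradient inequality (`grad_dotProduct_sub_le`):
`⟨g, λ - v⟩` is at most the difference of the dual integrands at `v` and at `λ`, plus estimation
errors. The mean of that difference is nonpositive because `v` is optimal. Its fluctuation is a
martingale whose increments are of order `√d R_k` while the iterates stay in the ball, so
Hoeffding–Azuma bounds it by `3 Υ_k R_k`. Feeding this into the telescoped squared distance returns
exactly `R_k ^ 2`, which closes an induction over rounds (`Setup.potential_le`,
`Setup.norm₂_lam_sub_le`).

For the costs, the iterate dominates `γ_k` times the sum of the gradients of its regime, so the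
excess cost is at most `λ / γ_k` up to `4 Υ_k` per coordinate. In regime `K`, `‖v‖ / γ_K ≤ √T`, so
the excess never passes the threshold and regime `K` is never left (`Setup.regime_le`). At most `1 +
ilog T` regimes therefore occur. Each overshoots by at most a threshold plus one round, and the
margin `b` is chosen to pay for all of them.

For the regret, the rewards are compared with the dual integrand at `v`, regime by regime: a
deviation term `3 Υ_k R_k`, a descent term `2 d γ_k T` obtained by comparison with the point `0`,
and estimation errors. Summing the geometric step sizes gives the bound. All deviation and accuracy
events hold together by a union bound over the regimes, with risks summing to less than `δ`. -/

noncomputable section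

namespace CBwK

/-! ### Hoeffding–Azuma inequality -/

section Azuma

/-- The chord of the exponential over `[-w, w]` lies above its graph. -/
theorem exp_mul_le_cosh_add_sinh {s w z : ℝ} (hw : 0 < w) (hz : |z| ≤ w) :
    Real.exp (s * z) ≤ Real.cosh (s * w) + Real.sinh (s * w) / w * z := by
  obtain ⟨h1, h2⟩ := abs_le.mp hz
  have h := (convexOn_exp).2 (Set.mem_univ (-(s * w))) (Set.mem_univ (s * w))
    (div_nonneg (by linarith) (by linarith) : 0 ≤ (w - z) / (2 * w))
    (div_nonneg (by linarith) (by linarith) : 0 ≤ (w + z) / (2 * w)) (by field_simp; ring)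
  simp only [smul_eq_mul] at h
  have e : (w - z) / (2 * w) * -(s * w) + (w + z) / (2 * w) * (s * w) = s * z := by
    field_simp; ring
  rw [e] at h
  refine h.trans (le_of_eq ?_)
  rw [Real.cosh_eq, Real.sinh_eq]
  field_simp
  ring

variable {Ω : Type*} {mΩ : MeasurableSpace Ω} {μ : Measure Ω} [IsProbabilityMeasure μ]

/-- Bounded measurable real functions are integrable for a probability measure. -/
theorem integrable_of_abs_le {f : Ω → ℝ} (hf : Measurable f) {C : ℝ} (hC : ∀ ω, |f ω| ≤ C) :
    Integrable f μ :=
  Integrable.of_bound hf.aestronglyMeasurable C (Filter.Eventually.of_forall hC)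

/-- Bound on the Laplace transform of a sum of bounded supermartingale increments. -/
theorem integral_exp_sum_le (m : ℕ → MeasurableSpace Ω) (hmono : Monotone m)
    (hle : ∀ t, m t ≤ mΩ) (Z : ℕ → Ω → ℝ) {w : ℝ} (hw : 0 < w) {s : ℝ} (hs : 0 ≤ s) (N : ℕ)
    (hZ : ∀ t < N, Measurable[m (t + 1)] (Z t)) (hb : ∀ t < N, ∀ ω, |Z t ω| ≤ w)
    (hc : ∀ t < N, ∀ g : Ω → ℝ, Measurable[m t] g → (∀ ω, 0 ≤ g ω) → (∃ C, ∀ ω, g ω ≤ C) →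
      ∫ ω, g ω * Z t ω ∂μ ≤ 0) :
    ∫ ω, Real.exp (s * ∑ τ ∈ Finset.range N, Z τ ω) ∂μ ≤ Real.exp (N * (s ^ 2 * w ^ 2 / 2)) := by
  induction N with
  | zero => simp
  | succ n ih =>
    have ih' := ih (fun t ht => hZ t (by omega)) (fun t ht => hb t (by omega))
      (fun t ht => hc t (by omega))
    set g : Ω → ℝ := fun ω => Real.exp (s * ∑ τ ∈ Finset.range n, Z τ ω) with hg
    have hgm : Measurable[m n] g := by
      refine Real.measurable_exp.comp (Measurable.const_mul ?_ s)
      refine Finset.measurable_sum _ fun τ hτ => ?_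
      have hτ' := Finset.mem_range.mp hτ
      exact (hZ τ (by omega)).mono (hmono (by omega)) le_rfl
    have hg0 : ∀ ω, 0 ≤ g ω := fun ω => (Real.exp_pos _).le
    have hgb : ∀ ω, g ω ≤ Real.exp (s * (n * w)) := by
      intro ω
      refine Real.exp_le_exp.mpr (mul_le_mul_of_nonneg_left ?_ hs)
      calc ∑ τ ∈ Finset.range n, Z τ ω ≤ ∑ τ ∈ Finset.range n, w :=
            Finset.sum_le_sum fun τ hτ =>
              (le_abs_self _).trans (hb τ (by have := Finset.mem_range.mp hτ; omega) ω)
        _ = n * w := by simp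
    have hZm : Measurable (Z n) := (hZ n (by omega)).mono (hle _) le_rfl
    have hgm' : Measurable g := hgm.mono (hle _) le_rfl
    have hgi : Integrable g μ :=
      integrable_of_abs_le hgm' (fun ω => by rw [abs_of_nonneg (hg0 ω)]; exact hgb ω)
    have hgZi : Integrable (fun ω => g ω * Z n ω) μ := by
      refine integrable_of_abs_le (hgm'.mul hZm) (C := Real.exp (s * (n * w)) * w) fun ω => ?_
      rw [abs_mul, abs_of_nonneg (hg0 ω)]
      exact mul_le_mul (hgb ω) (hb n (by omega) ω) (abs_nonneg _) (Real.exp_pos _).le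
    have hsinh : 0 ≤ Real.sinh (s * w) / w :=
      div_nonneg (Real.sinh_nonneg_iff.mpr (by positivity)) hw.le
    -- The chord bound is affine in `Z n`, so the supermartingale property is needed only in its
    -- weak form, tested against the bounded weight `g`; no conditional expectation appears.
    have key : ∫ ω, Real.exp (s * ∑ τ ∈ Finset.range (n + 1), Z τ ω) ∂μ
        ≤ Real.cosh (s * w) * ∫ ω, g ω ∂μ + Real.sinh (s * w) / w * ∫ ω, g ω * Z n ω ∂μ := by
      rw [← integral_const_mul, ← integral_const_mul,
        ← integral_add (hgi.const_mul _) (hgZi.const_mul _)]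
      refine integral_mono_of_nonneg (Filter.Eventually.of_forall fun ω => (Real.exp_pos _).le)
        ((hgi.const_mul _).add (hgZi.const_mul _)) (Filter.Eventually.of_forall fun ω => ?_)
      have h1 : Real.exp (s * ∑ τ ∈ Finset.range (n + 1), Z τ ω)
          = g ω * Real.exp (s * Z n ω) := by
        rw [Finset.sum_range_succ, mul_add, Real.exp_add]
      have h2 := mul_le_mul_of_nonneg_left
        (exp_mul_le_cosh_add_sinh (s := s) hw (hb n (by omega) ω)) (hg0 ω)
      simp only [h1]
      refine h2.trans (le_of_eq ?_)
      ring
    have h3 := hc n (by omega) g hgm hg0 ⟨_, hgb⟩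
    have h4 : Real.cosh (s * w) ≤ Real.exp (s ^ 2 * w ^ 2 / 2) := by
      refine (Real.cosh_le_exp_half_sq _).trans (le_of_eq ?_)
      ring_nf
    calc _ ≤ _ := key
      _ ≤ Real.cosh (s * w) * ∫ ω, g ω ∂μ := by nlinarith [mul_nonneg hsinh (neg_nonneg.mpr h3)]
      _ ≤ Real.exp (s ^ 2 * w ^ 2 / 2) * Real.exp (n * (s ^ 2 * w ^ 2 / 2)) :=
          mul_le_mul h4 ih' (integral_nonneg hg0) (Real.exp_pos _).le
      _ = _ := by rw [← Real.exp_add]; push_cast; ring_nf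

/-- Hoeffding–Azuma deviation inequality for bounded supermartingale increments. -/
theorem measure_lt_sum_le_exp_neg (m : ℕ → MeasurableSpace Ω) (hmono : Monotone m)
    (hle : ∀ t, m t ≤ mΩ) (Z : ℕ → Ω → ℝ) {w : ℝ} (hw : 0 < w) {N T : ℕ} (hT : 1 ≤ T) (hN : N ≤ T)
    (hZ : ∀ t < N, Measurable[m (t + 1)] (Z t)) (hb : ∀ t < N, ∀ ω, |Z t ω| ≤ w)
    (hc : ∀ t < N, ∀ g : Ω → ℝ, Measurable[m t] g → (∀ ω, 0 ≤ g ω) → (∃ C, ∀ ω, g ω ≤ C) →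
      ∫ ω, g ω * Z t ω ∂μ ≤ 0)
    {a L : ℝ} (ha : 0 ≤ a) (haL : 2 * T * w ^ 2 * L ≤ a ^ 2) :
    μ {ω | a < ∑ τ ∈ Finset.range N, Z τ ω} ≤ ENNReal.ofReal (Real.exp (-L)) := by
  have hT0 : (0 : ℝ) < T := by exact_mod_cast hT
  -- Minimizer of the Chernoff exponent `-s a + T s² w² / 2`.
  set s : ℝ := a / (T * w ^ 2) with hs
  have hs0 : 0 ≤ s := by positivity
  have hmgf := integral_exp_sum_le (μ := μ) m hmono hle Z hw hs0 N hZ hb hc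
  set S : Ω → ℝ := fun ω => ∑ τ ∈ Finset.range N, Z τ ω with hS
  have hSm : Measurable S := Finset.measurable_sum _ fun τ hτ =>
    (hZ τ (Finset.mem_range.mp hτ)).mono (hle _) le_rfl
  have hSb : ∀ ω, S ω ≤ N * w := fun ω => by
    calc S ω ≤ ∑ τ ∈ Finset.range N, w :=
          Finset.sum_le_sum fun τ hτ =>
            (le_abs_self _).trans (hb τ (Finset.mem_range.mp hτ) ω)
      _ = N * w := by simp
  have hint : Integrable (fun ω => Real.exp (s * S ω)) μ := by
    refine integrable_of_abs_le (Real.measurable_exp.comp (hSm.const_mul s))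
      (C := Real.exp (s * (N * w))) fun ω => ?_
    rw [abs_of_pos (Real.exp_pos _)]
    exact Real.exp_le_exp.mpr (mul_le_mul_of_nonneg_left (hSb ω) hs0)
  have hch := measure_ge_le_exp_mul_mgf (μ := μ) (X := S) a hs0 hint
  have hsub : μ {ω | a < S ω} ≤ μ {ω | a ≤ S ω} :=
    measure_mono fun ω (h : a < S ω) => le_of_lt h
  refine hsub.trans ?_
  rw [← ofReal_measureReal]
  refine ENNReal.ofReal_le_ofReal (hch.trans ?_)
  have hNT : (N : ℝ) ≤ T := by exact_mod_cast hN
  calc Real.exp (-s * a) * mgf S μ s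
      ≤ Real.exp (-s * a) * Real.exp (N * (s ^ 2 * w ^ 2 / 2)) :=
        mul_le_mul_of_nonneg_left hmgf (Real.exp_pos _).le
    _ = Real.exp (-s * a + N * (s ^ 2 * w ^ 2 / 2)) := by rw [Real.exp_add]
    _ ≤ Real.exp (-L) := by
      refine Real.exp_le_exp.mpr ?_
      have h1 : (N : ℝ) * (s ^ 2 * w ^ 2 / 2) ≤ T * (s ^ 2 * w ^ 2 / 2) :=
        mul_le_mul_of_nonneg_right hNT (by positivity)
      have h2 : T * (s ^ 2 * w ^ 2 / 2) = a ^ 2 / (2 * T * w ^ 2) := by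
        rw [hs]; field_simp
      have h3 : s * a = 2 * (a ^ 2 / (2 * T * w ^ 2)) := by
        rw [hs]; field_simp
      have h4 : L ≤ a ^ 2 / (2 * T * w ^ 2) := by
        rw [le_div_iff₀ (by positivity)]; linarith
      linarith

end Azuma

/-! ### Centered variables are orthogonal to the past -/

section Orthogonality

variable {Ω X Y : Type*} {m mΩ : MeasurableSpace Ω} {μ : Measure Ω} [IsProbabilityMeasure μ]
  [MeasurableSpace X] [MeasurableSpace Y]

/-- Integration with respect to a variable independent of the past, the past being frozen. -/
theorem integral_eq_integral_integral_of_indep (hm : m ≤ mΩ) {x : Ω → X}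
    (hx : Measurable x) (hind : Indep m (MeasurableSpace.comap x inferInstance) μ)
    {W : Ω → Y} (hW : Measurable[m] W) {f : Y × X → ℝ} (hf : Measurable f) {C : ℝ}
    (hC : ∀ q, |f q| ≤ C) :
    ∫ ω, f (W ω, x ω) ∂μ = ∫ ω, ∫ x', f (W ω, x') ∂(μ.map x) ∂μ := by
  have hW' : Measurable W := hW.mono hm le_rfl
  have hind' : IndepFun W x μ := by
    rw [IndepFun_iff_Indep]
    exact indep_of_indep_of_le_left hind (measurable_iff_comap_le.mp hW)
  have hprod := (indepFun_iff_map_prod_eq_prod_map_map hW'.aemeasurable hx.aemeasurable).mp hind'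
  have : IsProbabilityMeasure (μ.map x) := Measure.isProbabilityMeasure_map hx.aemeasurable
  have : IsProbabilityMeasure (μ.map W) := Measure.isProbabilityMeasure_map hW'.aemeasurable
  have h1 : ∫ ω, f (W ω, x ω) ∂μ = ∫ q, f q ∂(μ.map fun ω => (W ω, x ω)) :=
    (integral_map (hW'.prodMk hx).aemeasurable hf.aestronglyMeasurable).symm
  rw [h1, hprod, integral_prod _ (integrable_of_abs_le hf hC)]
  exact integral_map hW'.aemeasurable
    (hf.stronglyMeasurable.integral_prod_right').aestronglyMeasurable

/-- A bounded variable minus its conditional expectation is orthogonal to the past. -/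
theorem integral_mul_sub_condExp_eq_zero (hm : m ≤ mΩ) {f h g : Ω → ℝ}
    (hf : Measurable f) (hh : Measurable h) {C : ℝ} (hfC : ∀ ω, |f ω| ≤ C) (hhC : ∀ ω, |h ω| ≤ C)
    (hcond : μ[f | m] =ᵐ[μ] h) (hg : Measurable[m] g) {D : ℝ} (hgD : ∀ ω, |g ω| ≤ D) :
    ∫ ω, g ω * (f ω - h ω) ∂μ = 0 := by
  have hg' : Measurable g := hg.mono hm le_rfl
  have hD : ∀ (u : Ω → ℝ), Measurable u → (∀ ω, |u ω| ≤ C) → Integrable (g * u) μ := by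
    intro u hu huC
    refine integrable_of_abs_le (hg'.mul hu) (C := D * C) fun ω => ?_
    rw [Pi.mul_apply, abs_mul]
    exact mul_le_mul (hgD ω) (huC ω) (abs_nonneg _) ((abs_nonneg _).trans (hgD ω))
  have h1 : ∫ ω, (g * f) ω ∂μ = ∫ ω, (g * h) ω ∂μ := by
    rw [← integral_condExp hm]
    refine integral_congr_ae ?_
    have h2 := condExp_mul_of_stronglyMeasurable_left (μ := μ) hg.stronglyMeasurable
      (hD f hf hfC) (integrable_of_abs_le hf hfC)
    filter_upwards [h2, hcond] with ω h3 h4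
    rw [h3, Pi.mul_apply, Pi.mul_apply, h4]
  calc ∫ ω, g ω * (f ω - h ω) ∂μ = ∫ ω, ((g * f) ω - (g * h) ω) ∂μ := by
        simp only [Pi.mul_apply, mul_sub]
    _ = 0 := by rw [integral_sub (hD f hf hfC) (hD h hh hhC), h1, sub_self]

end Orthogonality

/-! ### Euclidean norm on coordinate vectors -/

section Norm

variable {d : ℕ}

theorem norm₂_nonneg (v : Fin d → ℝ) : 0 ≤ norm₂ v := norm_nonneg _

theorem norm₂_sq (v : Fin d → ℝ) : norm₂ v ^ 2 = ∑ i, v i ^ 2 := by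
  simp [norm₂, EuclideanSpace.norm_sq_eq]

theorem norm₂_zero : norm₂ (0 : Fin d → ℝ) = 0 := by simp [norm₂]

theorem norm₂_neg (v : Fin d → ℝ) : norm₂ (-v) = norm₂ v := by simp [norm₂]

theorem norm₂_add_le (u v : Fin d → ℝ) : norm₂ (u + v) ≤ norm₂ u + norm₂ v := by
  simpa [norm₂] using norm_add_le (WithLp.toLp 2 u) (WithLp.toLp 2 v)

theorem norm₂_smul (a : ℝ) (v : Fin d → ℝ) : norm₂ (a • v) = |a| * norm₂ v := by
  simp [norm₂, norm_smul]

theorem norm₂_sub_comm (u v : Fin d → ℝ) : norm₂ (u - v) = norm₂ (v - u) := by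
  rw [← norm₂_neg, neg_sub]

theorem continuous_norm₂ : Continuous (norm₂ : (Fin d → ℝ) → ℝ) :=
  continuous_norm.comp (PiLp.continuous_toLp 2 _)

theorem norm₂_le_of_abs_le {u v : Fin d → ℝ} (h : ∀ i, |u i| ≤ |v i|) : norm₂ u ≤ norm₂ v := by
  refine le_of_sq_le_sq ?_ (norm₂_nonneg v)
  rw [norm₂_sq, norm₂_sq]
  exact Finset.sum_le_sum fun i _ => sq_le_sq.mpr (h i)

theorem abs_le_norm₂ (v : Fin d → ℝ) (i : Fin d) : |v i| ≤ norm₂ v := by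
  refine le_of_sq_le_sq ?_ (norm₂_nonneg v)
  rw [norm₂_sq, sq_abs]
  exact Finset.single_le_sum (f := fun i => v i ^ 2) (fun i _ => sq_nonneg _) (Finset.mem_univ i)

theorem norm₂_le_sqrt_mul {v : Fin d → ℝ} {a : ℝ} (ha : 0 ≤ a) (h : ∀ i, |v i| ≤ a) :
    norm₂ v ≤ √d * a := by
  refine le_of_sq_le_sq ?_ (by positivity)
  rw [norm₂_sq, mul_pow, Real.sq_sqrt (by positivity)]
  calc ∑ i, v i ^ 2 ≤ ∑ _i : Fin d, a ^ 2 :=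
        Finset.sum_le_sum fun i _ => sq_le_sq.mpr (by rw [abs_of_nonneg ha]; exact h i)
    _ = d * a ^ 2 := by simp

theorem abs_dotProduct_le (u v : Fin d → ℝ) : |u ⬝ᵥ v| ≤ norm₂ u * norm₂ v := by
  have := abs_real_inner_le_norm (WithLp.toLp 2 u) (WithLp.toLp 2 v)
  simpa [norm₂, EuclideanSpace.inner_toLp_toLp, dotProduct_comm] using this

theorem sum_abs_le_sqrt_mul_norm₂ (v : Fin d → ℝ) : ∑ i, |v i| ≤ √d * norm₂ v := by
  have h := abs_dotProduct_le (fun _ : Fin d => (1 : ℝ)) (fun i => |v i|)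
  have h1 : norm₂ (fun _ : Fin d => (1 : ℝ)) ≤ √d * 1 :=
    norm₂_le_sqrt_mul zero_le_one fun i => by simp
  have h2 : norm₂ (fun i => |v i|) ≤ norm₂ v := norm₂_le_of_abs_le fun i => by simp
  have h3 : (fun _ : Fin d => (1 : ℝ)) ⬝ᵥ (fun i => |v i|) = ∑ i, |v i| := by
    simp [dotProduct]
  rw [h3] at h
  calc ∑ i, |v i| ≤ _ := (le_abs_self _).trans h
    _ ≤ (√d * 1) * norm₂ v := mul_le_mul h1 h2 (norm₂_nonneg _) (by positivity)
    _ = _ := by ring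

theorem norm₂_le_sum_abs (v : Fin d → ℝ) : norm₂ v ≤ ∑ i, |v i| := by
  refine le_of_sq_le_sq ?_ (Finset.sum_nonneg fun i _ => abs_nonneg _)
  rw [norm₂_sq]
  simpa using Finset.sum_sq_le_sq_sum_of_nonneg (s := Finset.univ) (f := fun i => |v i|)
    (fun i _ => abs_nonneg _)

/-- Projecting onto the nonnegative orthant does not increase the distance to its points. -/
theorem norm₂_posPart_sub_le {u v : Fin d → ℝ} (hv : 0 ≤ v) : norm₂ (u⁺ - v) ≤ norm₂ (u - v) := by
  refine norm₂_le_of_abs_le fun i => ?_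
  have h := hv i
  simp only [Pi.zero_apply] at h
  simp only [Pi.sub_apply, Pi.posPart_apply]
  have h1 : (v i)⁺ = v i := posPart_of_nonneg h
  have h2 : |(u i)⁺ - (v i)⁺| ≤ |u i - v i| := by
    simpa [posPart_def] using abs_max_sub_max_le_abs (u i) (v i) 0
  rwa [h1] at h2

theorem norm₂_add_sq (u v : Fin d → ℝ) :
    norm₂ (u + v) ^ 2 = norm₂ u ^ 2 + 2 * (v ⬝ᵥ u) + norm₂ v ^ 2 := by
  simp only [norm₂_sq, dotProduct, Pi.add_apply, Finset.mul_sum, ← Finset.sum_add_distrib]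
  exact Finset.sum_congr rfl fun i _ => by ring

end Norm

/-! ### The dual objective: regularity, coercivity, weak duality -/

section Dual

variable {X A : Type*} [MeasurableSpace X] {d : ℕ}

namespace Problem

/-- The integrand of the dual objective. -/
def gain (P : Problem X A d) (B lam : Fin d → ℝ) (x : X) : ℝ :=
  ⨆ a, (P.r x a - (P.c x a - B) ⬝ᵥ lam)

theorem dual_eq_integral_gain (P : Problem X A d) (B lam : Fin d → ℝ) :
    P.dual B lam = ∫ x, P.gain B lam x ∂P.ν := rfl

theorem norm₂_cost_sub_le (P : Problem X A d) {B : Fin d → ℝ} (hB : ∀ i, |B i| ≤ 1) (x : X)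
    (a : A) : norm₂ (P.c x a - B) ≤ 2 * √d := by
  rw [mul_comm]
  refine norm₂_le_sqrt_mul zero_le_two fun i => ?_
  have h1 := P.c_mem x a i
  have h2 := abs_le.mp (hB i)
  rw [Pi.sub_apply, abs_le]
  constructor <;> linarith [h1.1, h1.2]

theorem gain_le [Nonempty A] (P : Problem X A d) (B lam : Fin d → ℝ) (x : X) {u : ℝ}
    (h : ∀ a, P.r x a - (P.c x a - B) ⬝ᵥ lam ≤ u) : P.gain B lam x ≤ u :=
  ciSup_le h

variable [Fintype A]

theorem le_gain (P : Problem X A d) (B lam : Fin d → ℝ) (x : X) (a : A) :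
    P.r x a - (P.c x a - B) ⬝ᵥ lam ≤ P.gain B lam x :=
  le_ciSup (f := fun a => P.r x a - (P.c x a - B) ⬝ᵥ lam) (Set.finite_range _).bddAbove a

theorem measurable_gain (P : Problem X A d) (B : Fin d → ℝ) :
    Measurable fun q : (Fin d → ℝ) × X => P.gain B q.1 q.2 := by
  unfold gain
  refine Measurable.iSup fun a => ?_
  have h1 := P.r_meas a
  have h2 := fun i => (measurable_pi_iff.mp (P.c_meas a)) i
  refine (h1.comp measurable_snd).sub ?_
  unfold dotProduct
  refine Finset.measurable_sum _ fun i _ => ?_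
  exact (((h2 i).comp measurable_snd).sub measurable_const).mul
    ((measurable_pi_apply i).comp measurable_fst)

theorem measurable_gain_right (P : Problem X A d) (B lam : Fin d → ℝ) :
    Measurable (P.gain B lam) :=
  (P.measurable_gain B).comp measurable_prodMk_left

variable [Nonempty A]

/-- A maximum of affine functions whose slopes `c - B` have norm at most `2√d`. This is what makes
the deviations proportional to the distance between the dual variables. -/
theorem gain_sub_gain_le (P : Problem X A d) {B : Fin d → ℝ} (hB : ∀ i, |B i| ≤ 1)
    (u v : Fin d → ℝ) (x : X) : P.gain B u x - P.gain B v x ≤ 2 * √d * norm₂ (u - v) := by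
  rw [sub_le_iff_le_add']
  refine P.gain_le B u x fun a => ?_
  have h1 := P.le_gain B v x a
  have h2 := abs_dotProduct_le (P.c x a - B) (u - v)
  have h3 := mul_le_mul_of_nonneg_right (P.norm₂_cost_sub_le hB x a) (norm₂_nonneg (u - v))
  have h4 := abs_le.mp (h2.trans h3)
  rw [dotProduct_sub] at h4
  linarith [h4.1]

theorem abs_gain_sub_gain_le (P : Problem X A d) {B : Fin d → ℝ} (hB : ∀ i, |B i| ≤ 1)
    (u v : Fin d → ℝ) (x : X) : |P.gain B u x - P.gain B v x| ≤ 2 * √d * norm₂ (u - v) := by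
  refine abs_le.mpr ⟨?_, P.gain_sub_gain_le hB u v x⟩
  have := P.gain_sub_gain_le hB v u x
  rw [norm₂_sub_comm] at this
  linarith

theorem gain_zero_mem (P : Problem X A d) (B : Fin d → ℝ) (x : X) :
    P.gain B 0 x ∈ Set.Icc (0 : ℝ) 1 := by
  obtain ⟨a⟩ := ‹Nonempty A›
  constructor
  · have := P.le_gain B 0 x a
    rw [dotProduct_zero, sub_zero] at this
    exact (P.r_mem x a).1.trans this
  · exact P.gain_le B 0 x fun a => by
      rw [dotProduct_zero, sub_zero]; exact (P.r_mem x a).2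

theorem abs_gain_le (P : Problem X A d) {B : Fin d → ℝ} (hB : ∀ i, |B i| ≤ 1)
    (lam : Fin d → ℝ) (x : X) : |P.gain B lam x| ≤ 1 + 2 * √d * norm₂ lam := by
  have h1 := abs_le.mp (P.abs_gain_sub_gain_le hB lam 0 x)
  rw [sub_zero] at h1
  have h2 := P.gain_zero_mem B x
  exact abs_le.mpr ⟨by linarith [h1.1, h2.1], by linarith [h1.2, h2.2]⟩

theorem integrable_gain (P : Problem X A d) {B : Fin d → ℝ} (hB : ∀ i, |B i| ≤ 1)
    (lam : Fin d → ℝ) : Integrable (P.gain B lam) P.ν :=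
  have := P.prob
  integrable_of_abs_le (P.measurable_gain_right B lam) (P.abs_gain_le hB lam)

theorem abs_dual_sub_dual_le (P : Problem X A d) {B : Fin d → ℝ} (hB : ∀ i, |B i| ≤ 1)
    (u v : Fin d → ℝ) : |P.dual B u - P.dual B v| ≤ 2 * √d * norm₂ (u - v) := by
  have := P.prob
  rw [dual_eq_integral_gain, dual_eq_integral_gain,
    ← integral_sub (P.integrable_gain hB u) (P.integrable_gain hB v)]
  have h := norm_integral_le_of_norm_le_const (μ := P.ν)
    (f := fun x => P.gain B u x - P.gain B v x)
    (Filter.Eventually.of_forall (P.abs_gain_sub_gain_le hB u v))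
  simpa using h

theorem continuous_dual (P : Problem X A d) {B : Fin d → ℝ} (hB : ∀ i, |B i| ≤ 1) :
    Continuous (P.dual B) := by
  rw [continuous_iff_continuousAt]
  intro v
  rw [ContinuousAt, tendsto_iff_dist_tendsto_zero]
  have h0 : Filter.Tendsto (fun u => 2 * √d * norm₂ (u - v)) (nhds v) (nhds 0) := by
    have hc : Continuous fun u : Fin d → ℝ => 2 * √d * norm₂ (u - v) :=
      continuous_const.mul (continuous_norm₂.comp (continuous_id.sub continuous_const))
    simpa [norm₂_zero] using hc.tendsto v
  exact squeeze_zero (fun _ => dist_nonneg)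
    (fun u => by rw [Real.dist_eq]; exact P.abs_dual_sub_dual_le hB u v) h0

theorem dual_zero_le_one (P : Problem X A d) (B : Fin d → ℝ) : P.dual B 0 ≤ 1 := by
  have := P.prob
  have h := norm_integral_le_of_norm_le_const (μ := P.ν) (f := P.gain B 0) (C := 1)
    (Filter.Eventually.of_forall fun x => by
      have := P.gain_zero_mem B x
      rw [Real.norm_eq_abs, abs_of_nonneg this.1]; exact this.2)
  rw [dual_eq_integral_gain]
  simpa using (le_abs_self _).trans h

/-- Weak duality: the Lagrangian of a policy is at most the dual objective. -/
theorem reward_sub_le_dual (P : Problem X A d) {B : Fin d → ℝ} (hB : ∀ i, |B i| ≤ 1)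
    {π : X → A → ℝ} (hπ : IsPolicy π) (lam : Fin d → ℝ) :
    P.reward π - (P.cost π - B) ⬝ᵥ lam ≤ P.dual B lam := by
  have := P.prob
  have hπ1 : ∀ x a, π x a ≤ 1 := fun x a => by
    rw [← hπ.sum_eq_one x]
    exact Finset.single_le_sum (f := π x) (fun a _ => hπ.nonneg x a) (Finset.mem_univ a)
  have hr : Integrable (fun x => ∑ a, P.r x a * π x a) P.ν := by
    refine integrable_finsetSum _ fun a _ =>
      integrable_of_abs_le ((P.r_meas a).mul (hπ.meas a)) (C := 1) fun x => ?_
    have h1 := P.r_mem x a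
    rw [abs_mul, abs_of_nonneg h1.1, abs_of_nonneg (hπ.nonneg x a)]
    exact mul_le_one₀ h1.2 (hπ.nonneg x a) (hπ1 x a)
  have hc : ∀ i, Integrable (fun x => ∑ a, P.c x a i * π x a) P.ν := fun i => by
    refine integrable_finsetSum _ fun a _ =>
      integrable_of_abs_le ((measurable_pi_iff.mp (P.c_meas a) i).mul (hπ.meas a))
        (C := 1) fun x => ?_
    have h1 := abs_le.mpr (P.c_mem x a i)
    rw [abs_mul, abs_of_nonneg (hπ.nonneg x a)]
    exact mul_le_one₀ h1 (hπ.nonneg x a) (hπ1 x a)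
  have hci : ∀ i, Integrable (fun x => (∑ a, P.c x a i * π x a - B i) * lam i) P.ν :=
    fun i => ((hc i).sub (integrable_const _)).mul_const _
  have hint : Integrable (fun x => ∑ i, (∑ a, P.c x a i * π x a - B i) * lam i) P.ν :=
    integrable_finsetSum _ fun i _ => hci i
  have h1 : P.reward π - (P.cost π - B) ⬝ᵥ lam
      = ∫ x, (∑ a, P.r x a * π x a - ∑ i, (∑ a, P.c x a i * π x a - B i) * lam i) ∂P.ν := by
    rw [integral_sub hr hint, integral_finsetSum _ (fun i _ => hci i)]
    congr 1
    refine Finset.sum_congr rfl fun i _ => ?_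
    rw [integral_mul_const, integral_sub (hc i) (integrable_const _)]
    simp [cost]
  rw [h1, dual_eq_integral_gain]
  refine integral_mono (hr.sub hint) (P.integrable_gain hB lam) fun x => ?_
  have h2 : ∑ a, π x a * (P.r x a - (P.c x a - B) ⬝ᵥ lam) ≤ ∑ a, π x a * P.gain B lam x :=
    Finset.sum_le_sum fun a _ => mul_le_mul_of_nonneg_left (P.le_gain B lam x a) (hπ.nonneg x a)
  rw [← Finset.sum_mul, hπ.sum_eq_one x, one_mul] at h2
  refine le_trans (le_of_eq ?_) h2
  simp only [mul_sub, Finset.sum_sub_distrib, dotProduct, Pi.sub_apply]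
  congr 1
  · exact Finset.sum_congr rfl fun a _ => mul_comm _ _
  · simp only [Finset.mul_sum]
    rw [Finset.sum_comm]
    refine Finset.sum_congr rfl fun i _ => ?_
    have h3 : B i = ∑ a, π x a * B i := by rw [← Finset.sum_mul, hπ.sum_eq_one x, one_mul]
    conv_lhs => rw [h3]
    rw [← Finset.sum_sub_distrib, Finset.sum_mul]
    exact Finset.sum_congr rfl fun a _ => by ring

/-- Feasibility with an extra margin `b` makes the dual objective coercive. -/
theorem margin_mul_sum_le_dual (P : Problem X A d) {B : Fin d → ℝ} (hB : ∀ i, |B i| ≤ 1) {b : ℝ}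
    (hf : P.Feasible (shift B b)) {lam : Fin d → ℝ} (hlam : 0 ≤ lam) :
    b * ∑ i, lam i ≤ P.dual B lam := by
  obtain ⟨π, hπ, hcost⟩ := hf
  have h1 := P.reward_sub_le_dual hB hπ lam
  have h2 : 0 ≤ P.reward π := integral_nonneg fun x =>
    Finset.sum_nonneg fun a _ => mul_nonneg (P.r_mem x a).1 (hπ.nonneg x a)
  have h3 : (P.cost π - B) ⬝ᵥ lam ≤ -(b * ∑ i, lam i) := by
    rw [Finset.mul_sum, ← Finset.sum_neg_distrib]
    refine Finset.sum_le_sum fun i _ => ?_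
    have h4 := hcost i
    have h5 := hlam i
    simp only [shift, Pi.zero_apply] at h4 h5
    rw [Pi.sub_apply]
    nlinarith
  linarith

/-- Comparison with the point `0`, where the dual objective is at most `1`, against the coercive
lower bound `b ∑ λ_i`. -/
theorem norm₂_le_of_isDualOptimal (P : Problem X A d) {B : Fin d → ℝ} (hB : ∀ i, |B i| ≤ 1) {b : ℝ}
    (hb : 0 < b) (hf : P.Feasible (shift B b)) {lam : Fin d → ℝ} (hlam : P.IsDualOptimal B lam) :
    norm₂ lam ≤ 1 / b := by
  have h1 := P.margin_mul_sum_le_dual hB hf hlam.1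
  have h2 := (hlam.2 0 le_rfl).trans (P.dual_zero_le_one B)
  have h3 := norm₂_le_sum_abs lam
  have h4 : ∑ i, |lam i| = ∑ i, lam i :=
    Finset.sum_congr rfl fun i _ => abs_of_nonneg (hlam.1 i)
  rw [h4] at h3
  rw [le_div_iff₀ hb]
  nlinarith

/-- It suffices to minimize over the compact box `[0, 1/b]^d`: outside it some coordinate exceeds
`1/b`, so coercivity pushes the objective above `1`, hence above its value at `0`. -/
theorem exists_isDualOptimal (P : Problem X A d) {B : Fin d → ℝ} (hB : ∀ i, |B i| ≤ 1) {b : ℝ}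
    (hb : 0 < b) (hf : P.Feasible (shift B b)) : ∃ lam, P.IsDualOptimal B lam := by
  obtain ⟨lam, hmem, hmin⟩ :=
    (isCompact_Icc (a := (0 : Fin d → ℝ)) (b := fun _ => 1 / b)).exists_isMinOn
      ⟨0, le_rfl, fun i => by simp only [Pi.zero_apply]; positivity⟩
      (P.continuous_dual hB).continuousOn
  refine ⟨lam, hmem.1, fun v hv => ?_⟩
  by_cases hv' : v ≤ fun _ => 1 / b
  · exact hmin ⟨hv, hv'⟩
  · obtain ⟨i, hi⟩ : ∃ i, 1 / b < v i := by
      simpa [Pi.le_def] using hv'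
    have h1 := hmin (show (0 : Fin d → ℝ) ∈ Set.Icc 0 (fun _ => 1 / b) from
      ⟨le_rfl, fun i => by simp only [Pi.zero_apply]; positivity⟩)
    have h2 := P.margin_mul_sum_le_dual hB hf hv
    have h3 : v i ≤ ∑ j, v j := Finset.single_le_sum (f := v) (fun j _ => hv j) (Finset.mem_univ i)
    have h4 : 1 < b * v i := by rwa [div_lt_iff₀' hb] at hi
    have h5 := mul_le_mul_of_nonneg_left h3 hb.le
    have h6 := P.dual_zero_le_one B
    exact (h1.trans h6).trans (by linarith)

/-- The value of the problem is at most the dual objective of a tightened problem, up to the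
price of the tightening. -/
theorem opt_le_dual_shift_add (P : Problem X A d) {B : Fin d → ℝ} {b : ℝ} (hb : 0 ≤ b)
    (hB : ∀ i, |shift B b i| ≤ 1) (hf : P.Feasible B) {lam : Fin d → ℝ} (hlam : 0 ≤ lam) :
    P.opt B ≤ P.dual (shift B b) lam + b * √d * norm₂ lam := by
  obtain ⟨π₀, hπ₀, hc₀⟩ := hf
  refine csSup_le ⟨_, π₀, hπ₀, hc₀, rfl⟩ ?_
  rintro _ ⟨π, hπ, hc, rfl⟩
  have h1 := P.reward_sub_le_dual hB hπ lam
  have h2 : (P.cost π - shift B b) ⬝ᵥ lam ≤ b * ∑ i, |lam i| := by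
    rw [Finset.mul_sum]
    refine Finset.sum_le_sum fun i _ => ?_
    have h4 := hc i
    have h5 := hlam i
    simp only [Pi.zero_apply] at h5
    rw [Pi.sub_apply, abs_of_nonneg h5, shift]
    nlinarith
  have h3 := mul_le_mul_of_nonneg_left (sum_abs_le_sqrt_mul_norm₂ lam) hb
  linarith

end Problem

end Dual

/-! ### Pathwise dynamics of regimes and dual variables -/

section Trajectory

variable {X A : Type*} [MeasurableSpace X] [MeasurableSpace A] {d : ℕ}
  (E : Estimator X A d) (T : ℕ) (β : ℝ → ℝ) (δ : ℝ) (B : Fin d → ℝ) (b : ℝ) (o : ℕ → Obs X A d)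

/-- The (sub)gradient used in round `t` to update the dual variable. -/
def grad (t : ℕ) : Fin d → ℝ :=
  E.cLcb (riskLevel δ (state E T β δ B b o t).regime) t (hist o t) (o t).1 (o t).2.1 - shift B b

/-- The outcome of the projected gradient step of round `t`, whether or not the regime goes on. -/
def nextLam (t : ℕ) : Fin d → ℝ :=
  ((state E T β δ B b o t).lam
    + stepSize T (state E T β δ B b o t).regime • grad E T β δ B b o t)⁺

/-- The excess costs accumulated over the current regime, up to round `t` included. -/
def excess (t : ℕ) : Fin d → ℝ :=
  (∑ τ ∈ Finset.Ico (state E T β δ B b o t).start (t + 1), (o τ).2.2.2)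
    - ((t + 1 - (state E T β δ B b o t).start : ℕ) : ℝ) • shift B b

theorem state_succ_of_lt {t : ℕ}
    (h : threshold d T β δ (state E T β δ B b o t).regime < norm₂ (excess E T β δ B b o t)⁺) :
    state E T β δ B b o (t + 1) = ⟨(state E T β δ B b o t).regime + 1, t + 1, 0⟩ :=
  if_pos h

theorem state_succ_of_le {t : ℕ}
    (h : norm₂ (excess E T β δ B b o t)⁺ ≤ threshold d T β δ (state E T β δ B b o t).regime) :
    state E T β δ B b o (t + 1) = ⟨(state E T β δ B b o t).regime,
      (state E T β δ B b o t).start, nextLam E T β δ B b o t⟩ :=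
  if_neg (not_lt.mpr h)

theorem regime_le_succ (t : ℕ) :
    (state E T β δ B b o t).regime ≤ (state E T β δ B b o (t + 1)).regime := by
  rcases lt_or_ge (threshold d T β δ (state E T β δ B b o t).regime)
    (norm₂ (excess E T β δ B b o t)⁺) with h | h
  · rw [state_succ_of_lt E T β δ B b o h]; exact Nat.le_succ _
  · rw [state_succ_of_le E T β δ B b o h]

theorem regime_monotone : Monotone fun t => (state E T β δ B b o t).regime :=
  monotone_nat_of_le_succ (regime_le_succ E T β δ B b o)

theorem start_le (t : ℕ) : (state E T β δ B b o t).start ≤ t := by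
  induction t with
  | zero => exact le_rfl
  | succ t ih =>
    rcases lt_or_ge (threshold d T β δ (state E T β δ B b o t).regime)
      (norm₂ (excess E T β δ B b o t)⁺) with h | h
    · rw [state_succ_of_lt E T β δ B b o h]
    · rw [state_succ_of_le E T β δ B b o h]; exact ih.trans (Nat.le_succ _)

theorem lam_nonneg (t : ℕ) : 0 ≤ (state E T β δ B b o t).lam := by
  cases t with
  | zero => exact le_rfl
  | succ t =>
    rcases lt_or_ge (threshold d T β δ (state E T β δ B b o t).regime)
      (norm₂ (excess E T β δ B b o t)⁺) with h | h
    · rw [state_succ_of_lt E T β δ B b o h]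
    · rw [state_succ_of_le E T β δ B b o h]; exact posPart_nonneg _

theorem nextLam_nonneg (t : ℕ) : 0 ≤ nextLam E T β δ B b o t := posPart_nonneg _

/-- The current regime consists of the rounds since its start. -/
theorem regime_eq_iff {t τ : ℕ} (hτ : τ ≤ t) :
    (state E T β δ B b o τ).regime = (state E T β δ B b o t).regime
      ↔ (state E T β δ B b o t).start ≤ τ := by
  induction t with
  | zero =>
    obtain rfl : τ = 0 := by omega
    simp [state]
  | succ t ih =>
    rcases Nat.lt_or_ge t τ with h1 | h1
    · obtain rfl : τ = t + 1 := by omega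
      simpa using start_le E T β δ B b o (t + 1)
    · rcases lt_or_ge (threshold d T β δ (state E T β δ B b o t).regime)
        (norm₂ (excess E T β δ B b o t)⁺) with h | h
      · rw [state_succ_of_lt E T β δ B b o h]
        have := regime_monotone E T β δ B b o h1
        simp only at this ⊢
        omega
      · rw [state_succ_of_le E T β δ B b o h]
        exact ih h1

/-- Replaces a sum with random endpoints by one with indicators of a fixed regime. Such an indicator
is known before the round is played, so the sum becomes a martingale once its terms are centered. -/
theorem sum_Ico_start_eq (f : ℕ → ℝ) (t : ℕ) :
    ∑ τ ∈ Finset.Ico (state E T β δ B b o t).start (t + 1), f τ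
      = ∑ τ ∈ Finset.range (t + 1),
        if (state E T β δ B b o τ).regime = (state E T β δ B b o t).regime then f τ else 0 := by
  rw [← Finset.sum_filter]
  refine Finset.sum_congr ?_ fun _ _ => rfl
  ext τ
  simp only [Finset.mem_Ico, Finset.mem_filter, Finset.mem_range]
  constructor
  · rintro ⟨h1, h2⟩
    exact ⟨h2, (regime_eq_iff E T β δ B b o (by omega)).mpr h1⟩
  · rintro ⟨h1, h2⟩
    exact ⟨(regime_eq_iff E T β δ B b o (by omega)).mp h2, h1⟩

theorem excess_apply (t : ℕ) (i : Fin d) :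
    excess E T β δ B b o t i = ∑ τ ∈ Finset.Ico (state E T β δ B b o t).start (t + 1),
      ((o τ).2.2.2 i - shift B b i) := by
  simp [excess, Finset.sum_sub_distrib]

theorem excess_apply_eq_sum_ite (t : ℕ) (i : Fin d) :
    excess E T β δ B b o t i = ∑ τ ∈ Finset.range (t + 1),
      if (state E T β δ B b o τ).regime = (state E T β δ B b o t).regime
        then (o τ).2.2.2 i - shift B b i else 0 := by
  rw [excess_apply, sum_Ico_start_eq]

/-- When a regime starts, no earlier round belongs to it. -/
theorem sum_ite_regime_eq_zero_of_lt {t k : ℕ} (h : (state E T β δ B b o t).regime < k)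
    (f : ℕ → ℝ) :
    ∑ τ ∈ Finset.range (t + 1), (if (state E T β δ B b o τ).regime = k then f τ else 0) = 0 := by
  refine Finset.sum_eq_zero fun τ hτ => if_neg ?_
  have := regime_monotone E T β δ B b o (Nat.lt_succ_iff.mp (Finset.mem_range.mp hτ))
  simp only at this
  omega

theorem stepSize_pos {T : ℕ} (hT : 1 ≤ T) (k : ℕ) : 0 < stepSize T k := by
  have : (0 : ℝ) < T := by exact_mod_cast hT
  unfold stepSize
  positivity

/-- Projection onto the orthant only increases coordinates, so the iterate dominates the unprojected
sum of steps; a new regime resets both sides to `0`. The second half covers the step of round `t`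
even when a regime switch discards it, because the switching test already includes that round. -/
theorem stepSize_mul_sum_grad_le_lam (t : ℕ) (i : Fin d) :
    stepSize T (state E T β δ B b o t).regime * (∑ τ ∈ Finset.range t,
      if (state E T β δ B b o τ).regime = (state E T β δ B b o t).regime
        then grad E T β δ B b o τ i else 0) ≤ (state E T β δ B b o t).lam i ∧
    stepSize T (state E T β δ B b o t).regime * (∑ τ ∈ Finset.range (t + 1),
      if (state E T β δ B b o τ).regime = (state E T β δ B b o t).regime
        then grad E T β δ B b o τ i else 0) ≤ nextLam E T β δ B b o t i := by
  have aux : ∀ t, stepSize T (state E T β δ B b o t).regime * (∑ τ ∈ Finset.range t,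
      if (state E T β δ B b o τ).regime = (state E T β δ B b o t).regime
        then grad E T β δ B b o τ i else 0) ≤ (state E T β δ B b o t).lam i →
      stepSize T (state E T β δ B b o t).regime * (∑ τ ∈ Finset.range (t + 1),
      if (state E T β δ B b o τ).regime = (state E T β δ B b o t).regime
        then grad E T β δ B b o τ i else 0) ≤ nextLam E T β δ B b o t i := by
    intro t h
    rw [Finset.sum_range_succ, if_pos rfl, mul_add]
    refine le_trans ?_ (le_posPart _)
    exact add_le_add_left h _
  suffices h : stepSize T (state E T β δ B b o t).regime * (∑ τ ∈ Finset.range t,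
      if (state E T β δ B b o τ).regime = (state E T β δ B b o t).regime
        then grad E T β δ B b o τ i else 0) ≤ (state E T β δ B b o t).lam i from ⟨h, aux t h⟩
  induction t with
  | zero => simp [state]
  | succ t ih =>
    rcases lt_or_ge (threshold d T β δ (state E T β δ B b o t).regime)
      (norm₂ (excess E T β δ B b o t)⁺) with h | h
    · have hs := state_succ_of_lt E T β δ B b o h
      have h1 : (state E T β δ B b o t).regime < (state E T β δ B b o (t + 1)).regime := by
        rw [hs]; exact Nat.lt_succ_self _
      rw [sum_ite_regime_eq_zero_of_lt E T β δ B b o h1, mul_zero, hs]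
      exact le_rfl
    · rw [state_succ_of_le E T β δ B b o h]
      exact aux t ih

/-- One step of projected gradient descent. -/
theorem norm₂_nextLam_sub_sq_le (t : ℕ) {v : Fin d → ℝ} (hv : 0 ≤ v) {G : ℝ}
    (hG : norm₂ (grad E T β δ B b o t) ^ 2 ≤ G) :
    norm₂ (nextLam E T β δ B b o t - v) ^ 2 ≤ norm₂ ((state E T β δ B b o t).lam - v) ^ 2
      + (2 * stepSize T (state E T β δ B b o t).regime
          * (grad E T β δ B b o t ⬝ᵥ ((state E T β δ B b o t).lam - v))
        + G * stepSize T (state E T β δ B b o t).regime ^ 2) := by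
  set γ := stepSize T (state E T β δ B b o t).regime
  set l := (state E T β δ B b o t).lam
  set g := grad E T β δ B b o t
  have h1 : norm₂ (nextLam E T β δ B b o t - v) ≤ norm₂ (l + γ • g - v) := norm₂_posPart_sub_le hv
  have h2 : l + γ • g - v = (l - v) + γ • g := by abel
  have h3 := pow_le_pow_left₀ (norm₂_nonneg _) h1 2
  rw [h2, norm₂_add_sq, norm₂_smul, mul_pow, sq_abs, smul_dotProduct, smul_eq_mul] at h3
  nlinarith [mul_le_mul_of_nonneg_left hG (sq_nonneg γ)]

/-- The potential of regime `k` at the beginning of round `t`, with respect to the point `v`. -/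
def potential (k : ℕ) (v : Fin d → ℝ) (t : ℕ) : ℝ :=
  norm₂ v ^ 2 + ∑ τ ∈ Finset.range t, if (state E T β δ B b o τ).regime = k then
    2 * stepSize T k * (grad E T β δ B b o τ ⬝ᵥ ((state E T β δ B b o τ).lam - v))
      + 4 * d * stepSize T k ^ 2 else 0

/-- Telescopes the one-step descent inequality. The potential is frozen outside regime `k` and
equals `‖v‖²` when that regime starts at `λ = 0`. It thus dominates a squared distance throughout
the regime and remains nonnegative afterwards, including after the last, discarded step. -/
theorem potential_bounds {v : Fin d → ℝ} (hv : 0 ≤ v)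
    (hG : ∀ t, norm₂ (grad E T β δ B b o t) ^ 2 ≤ 4 * d) (k t : ℕ) :
    0 ≤ potential E T β δ B b o k v t ∧ ((state E T β δ B b o t).regime = k →
      norm₂ ((state E T β δ B b o t).lam - v) ^ 2 ≤ potential E T β δ B b o k v t ∧
      norm₂ (nextLam E T β δ B b o t - v) ^ 2 ≤ potential E T β δ B b o k v (t + 1)) := by
  have aux : ∀ t, (state E T β δ B b o t).regime = k →
      norm₂ ((state E T β δ B b o t).lam - v) ^ 2 ≤ potential E T β δ B b o k v t →
      norm₂ (nextLam E T β δ B b o t - v) ^ 2 ≤ potential E T β δ B b o k v (t + 1) := by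
    intro t hk h
    have h1 := norm₂_nextLam_sub_sq_le E T β δ B b o t hv (hG t)
    rw [hk] at h1
    unfold potential at h ⊢
    rw [Finset.sum_range_succ, if_pos hk]
    linarith
  suffices h : 0 ≤ potential E T β δ B b o k v t ∧ ((state E T β δ B b o t).regime = k →
      norm₂ ((state E T β δ B b o t).lam - v) ^ 2 ≤ potential E T β δ B b o k v t) from
    ⟨h.1, fun hk => ⟨h.2 hk, aux t hk (h.2 hk)⟩⟩
  induction t with
  | zero =>
    have h0 : potential E T β δ B b o k v 0 = norm₂ v ^ 2 := by simp [potential]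
    rw [h0]
    refine ⟨sq_nonneg _, fun _ => ?_⟩
    simp [state, norm₂_neg]
  | succ t ih =>
    by_cases hk : (state E T β δ B b o t).regime = k
    · have h1 := aux t hk (ih.2 hk)
      refine ⟨(sq_nonneg _).trans h1, fun hk' => ?_⟩
      rcases lt_or_ge (threshold d T β δ (state E T β δ B b o t).regime)
        (norm₂ (excess E T β δ B b o t)⁺) with h | h
      · rw [state_succ_of_lt E T β δ B b o h] at hk'
        simp only at hk'
        omega
      · rw [state_succ_of_le E T β δ B b o h]
        exact h1
    · have h1 : potential E T β δ B b o k v (t + 1) = potential E T β δ B b o k v t := by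
        unfold potential
        rw [Finset.sum_range_succ, if_neg hk, add_zero]
      refine ⟨h1 ▸ ih.1, fun hk' => ?_⟩
      rcases lt_or_ge (threshold d T β δ (state E T β δ B b o t).regime)
        (norm₂ (excess E T β δ B b o t)⁺) with h | h
      · have hs := state_succ_of_lt E T β δ B b o h
        have h2 : (state E T β δ B b o t).regime < k := by
          rw [hs] at hk'; simp only at hk'; omega
        unfold potential
        rw [sum_ite_regime_eq_zero_of_lt E T β δ B b o h2, hs]
        simp [norm₂_neg]
      · rw [state_succ_of_le E T β δ B b o h] at hk'
        exact absurd hk' hk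

end Trajectory

/-! ### Confidence bounds for accurate estimates -/

section Optimism

variable {X A : Type*} [MeasurableSpace X] [MeasurableSpace A] {d : ℕ}

theorem clip_mem {l u : ℝ} (h : l ≤ u) (y : ℝ) : clip l u y ∈ Set.Icc l u :=
  ⟨le_min (le_max_right _ _) h, min_le_right _ _⟩

theorem norm₂_grad_sq_le (E : Estimator X A d) (T : ℕ) (β : ℝ → ℝ) (δ : ℝ) {B : Fin d → ℝ} {b : ℝ}
    (hB : ∀ i, |shift B b i| ≤ 1) (o : ℕ → Obs X A d) (t : ℕ) :
    norm₂ (grad E T β δ B b o t) ^ 2 ≤ 4 * d := by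
  have h : norm₂ (grad E T β δ B b o t) ≤ √d * 2 := by
    refine norm₂_le_sqrt_mul zero_le_two fun i => ?_
    have h1 := clip_mem (show (-1 : ℝ) ≤ 1 by norm_num)
      (E.cHat t (hist o t) (o t).1 (o t).2.1 i
        - E.errObs t (hist o t) (o t).1 (o t).2.1 (riskLevel δ (state E T β δ B b o t).regime))
    have h2 := abs_le.mp (hB i)
    unfold grad Estimator.cLcb
    rw [Pi.sub_apply, abs_le]
    constructor <;> linarith [h1.1, h1.2]
  have h1 := pow_le_pow_left₀ (norm₂_nonneg _) h 2
  rw [mul_pow, Real.sq_sqrt (by positivity)] at h1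
  linarith

/-- The estimates based on the history `h` are within the error functions at level `δ`. -/
def Accurate (P : Problem X A d) (E : Estimator X A d) (t : ℕ) (h : Fin t → Obs X A d)
    (δ : ℝ) : Prop :=
  ∀ (x : X) (a : A), |E.rHat t h x a - P.r x a| ≤ E.errObs t h x a δ ∧
    ∀ i, |E.cHat t h x a i - P.c x a i| ≤ E.errObs t h x a δ

variable {P : Problem X A d} {E : Estimator X A d} {t : ℕ} {h : Fin t → Obs X A d} {δ : ℝ}

theorem Accurate.errObs_nonneg (hA : Accurate P E t h δ) (x : X) (a : A) :
    0 ≤ E.errObs t h x a δ := (abs_nonneg _).trans (hA x a).1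

/-- Clipping preserves optimism because the true value already lies in the clipping interval. The
same reasoning underlies the three bounds that follow. -/
theorem Accurate.le_rUcb (hA : Accurate P E t h δ) (x : X) (a : A) :
    P.r x a ≤ E.rUcb δ t h x a := by
  have h1 := abs_le.mp (hA x a).1
  exact le_min (le_max_of_le_left (by linarith)) (P.r_mem x a).2

theorem Accurate.rUcb_le (hA : Accurate P E t h δ) (x : X) (a : A) :
    E.rUcb δ t h x a ≤ P.r x a + 2 * E.errObs t h x a δ := by
  have h1 := abs_le.mp (hA x a).1
  have h2 := hA.errObs_nonneg x a
  exact min_le_of_left_le (max_le (by linarith) (by linarith [(P.r_mem x a).1]))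

theorem Accurate.cLcb_le (hA : Accurate P E t h δ) (x : X) (a : A) (i : Fin d) :
    E.cLcb δ t h x a i ≤ P.c x a i := by
  have h1 := abs_le.mp ((hA x a).2 i)
  exact min_le_of_left_le (max_le (by linarith) (P.c_mem x a i).1)

theorem Accurate.le_cLcb (hA : Accurate P E t h δ) (x : X) (a : A) (i : Fin d) :
    P.c x a i - 2 * E.errObs t h x a δ ≤ E.cLcb δ t h x a i := by
  have h1 := abs_le.mp ((hA x a).2 i)
  have h2 := hA.errObs_nonneg x a
  exact le_min (le_max_of_le_left (by linarith)) (by linarith [(P.c_mem x a i).2])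

end Optimism

/-! ### Consequences of the choice of actions -/

section Play

variable {X A : Type*} [MeasurableSpace X] [MeasurableSpace A] [Nonempty A] {d : ℕ}
  {P : Problem X A d} {E : Estimator X A d} {T : ℕ} {β : ℝ → ℝ} {δ : ℝ} {B : Fin d → ℝ} {b : ℝ}
  {o : ℕ → Obs X A d}

/-- The error function at the pair played in round `t`, at the risk level of regime `k`. -/
def playErr (E : Estimator X A d) (δ : ℝ) (o : ℕ → Obs X A d) (k t : ℕ) : ℝ :=
  E.errObs t (hist o t) (o t).1 (o t).2.1 (riskLevel δ k)

/-- The score of the action played is optimistic. -/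
theorem gain_le_score (hF : FollowsMeta E T β δ B b o) {t : ℕ} (ht : t < T)
    (hA : Accurate P E t (hist o t) (riskLevel δ (state E T β δ B b o t).regime)) :
    P.gain (shift B b) (state E T β δ B b o t).lam (o t).1
      ≤ E.rUcb (riskLevel δ (state E T β δ B b o t).regime) t (hist o t) (o t).1 (o t).2.1
        - grad E T β δ B b o t ⬝ᵥ (state E T β δ B b o t).lam := by
  refine P.gain_le _ _ _ fun a => ?_
  refine le_trans ?_ (hF t ht a)
  unfold score
  refine sub_le_sub (hA.le_rUcb _ a) (Finset.sum_le_sum fun i _ => ?_)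
  refine mul_le_mul_of_nonneg_right ?_ (lam_nonneg E T β δ B b o t i)
  exact sub_le_sub_right (hA.cLcb_le _ a i) _

theorem gain_add_grad_le_reward (hF : FollowsMeta E T β δ B b o) {t : ℕ} (ht : t < T)
    (hA : Accurate P E t (hist o t) (riskLevel δ (state E T β δ B b o t).regime)) :
    P.gain (shift B b) (state E T β δ B b o t).lam (o t).1
        + grad E T β δ B b o t ⬝ᵥ (state E T β δ B b o t).lam
      ≤ P.r (o t).1 (o t).2.1 + 2 * playErr E δ o (state E T β δ B b o t).regime t := by
  have h1 := gain_le_score hF ht hA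
  have h2 := hA.rUcb_le (o t).1 (o t).2.1
  unfold playErr
  linarith

variable [Fintype A]

/-- Approximate subgradient inequality. At `λ`, the score of the played action dominates the true
maximum; at `v`, the same action is only one competitor in the maximum. Replacing its estimates by
the true values costs twice the error for the reward and, since `∑ v_i ≤ √d ‖v‖`, `√d ‖v‖` times
that for the costs. -/
theorem grad_dotProduct_sub_le (hF : FollowsMeta E T β δ B b o) {t : ℕ} (ht : t < T)
    (hA : Accurate P E t (hist o t) (riskLevel δ (state E T β δ B b o t).regime))
    {v : Fin d → ℝ} (hv : 0 ≤ v) :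
    grad E T β δ B b o t ⬝ᵥ ((state E T β δ B b o t).lam - v)
      ≤ P.gain (shift B b) v (o t).1 - P.gain (shift B b) (state E T β δ B b o t).lam (o t).1
        + 2 * (1 + √d * norm₂ v) * playErr E δ o (state E T β δ B b o t).regime t := by
  have h1 := gain_le_score hF ht hA
  have h2 := hA.rUcb_le (o t).1 (o t).2.1
  have h0 := hA.errObs_nonneg (o t).1 (o t).2.1
  have h3 := P.le_gain (shift B b) v (o t).1 (o t).2.1
  set ε := E.errObs t (hist o t) (o t).1 (o t).2.1
    (riskLevel δ (state E T β δ B b o t).regime) with hε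
  have h4 : (P.c (o t).1 (o t).2.1 - shift B b) ⬝ᵥ v - 2 * ε * ∑ i, |v i|
      ≤ grad E T β δ B b o t ⬝ᵥ v := by
    unfold dotProduct
    rw [Finset.mul_sum, ← Finset.sum_sub_distrib]
    refine Finset.sum_le_sum fun i _ => ?_
    have h5 := hA.le_cLcb (o t).1 (o t).2.1 i
    have h6 : 0 ≤ v i := hv i
    rw [abs_of_nonneg h6, grad, Pi.sub_apply, Pi.sub_apply]
    nlinarith
  have h5 := mul_le_mul_of_nonneg_left (sum_abs_le_sqrt_mul_norm₂ v) h0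
  rw [dotProduct_sub]
  unfold playErr
  rw [← hε]
  linarith

end Play

/-! ### Elementary inequalities on `Υ`, thresholds and step sizes -/

section ConstantBounds

variable {d T : ℕ} {β : ℝ → ℝ} {δ : ℝ}

/-- The value of `Υ` relevant for regime `k`. -/
def regimeUpsilon (d T : ℕ) (β : ℝ → ℝ) (δ : ℝ) (k : ℕ) : ℝ :=
  Upsilon d T β (δ / ((k : ℝ) + 2) ^ 2)

theorem div_sq_div_four_eq_riskLevel (δ : ℝ) (k : ℕ) :
    δ / ((k : ℝ) + 2) ^ 2 / 4 = riskLevel δ k := by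
  unfold riskLevel
  rw [div_div, mul_comm]

theorem riskLevel_pos (hδ : 0 < δ) (k : ℕ) : 0 < riskLevel δ k := by
  unfold riskLevel
  positivity

theorem riskLevel_le (hδ : 0 < δ) (k : ℕ) : riskLevel δ k ≤ δ / 16 := by
  unfold riskLevel
  have hk : (0 : ℝ) ≤ k := Nat.cast_nonneg k
  exact div_le_div_of_nonneg_left hδ.le (by norm_num) (by nlinarith)

theorem riskLevel_mem (hδ : 0 < δ) (hδ1 : δ < 1) (k : ℕ) : riskLevel δ k ∈ Set.Ioc (0 : ℝ) 1 :=
  ⟨riskLevel_pos hδ k, by linarith [riskLevel_le hδ k]⟩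

theorem riskLevel_antitone (hδ : 0 < δ) : Antitone (riskLevel δ) := by
  intro k l hkl
  have h1 : (k : ℝ) ≤ l := by exact_mod_cast hkl
  have hk : (0 : ℝ) ≤ k := Nat.cast_nonneg k
  unfold riskLevel
  exact div_le_div_of_nonneg_left hδ.le (by positivity) (by nlinarith)

theorem beta_le_regimeUpsilon (k : ℕ) : β (riskLevel δ k) ≤ regimeUpsilon d T β δ k := by
  unfold regimeUpsilon Upsilon
  rw [div_sq_div_four_eq_riskLevel]
  exact le_max_left _ _

theorem regimeUpsilon_nonneg (k : ℕ) : 0 ≤ regimeUpsilon d T β δ k :=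
  le_max_of_le_right (le_max_of_le_left (by positivity))

theorem log_sq_div_riskLevel_ge_one (hT : 1 ≤ T) (hδ : 0 < δ) (hδ1 : δ < 1) (k : ℕ) :
    1 ≤ Real.log ((T : ℝ) ^ 2 / riskLevel δ k) := by
  have hT' : (1 : ℝ) ≤ T := by exact_mod_cast hT
  have h0 := riskLevel_pos hδ k
  have h1 := riskLevel_le hδ k
  have h2 : (16 : ℝ) ≤ (T : ℝ) ^ 2 / riskLevel δ k := by
    rw [le_div_iff₀ h0]; nlinarith
  rw [Real.le_log_iff_exp_le (by linarith)]
  linarith [Real.exp_one_lt_d9]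

theorem log_div_riskLevel_nonneg (hT : 1 ≤ T) (hδ : 0 < δ) (hδ1 : δ < 1) (k : ℕ) :
    0 ≤ Real.log (2 * (d + 1) * T / riskLevel δ k) := by
  have hT' : (1 : ℝ) ≤ T := by exact_mod_cast hT
  have h0 := riskLevel_pos hδ k
  have h1 := riskLevel_le hδ k
  refine Real.log_nonneg ?_
  rw [le_div_iff₀ h0]
  nlinarith [mul_nonneg (Nat.cast_nonneg (α := ℝ) d) (Nat.cast_nonneg (α := ℝ) T)]

theorem four_mul_log_le_regimeUpsilon_sq (hT : 1 ≤ T) (hδ : 0 < δ) (hδ1 : δ < 1) (k : ℕ) :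
    4 * (d * T * Real.log ((T : ℝ) ^ 2 / riskLevel δ k)) ≤ regimeUpsilon d T β δ k ^ 2 := by
  have h0 := log_sq_div_riskLevel_ge_one hT hδ hδ1 k
  have h1 : 2 * √(d * T * Real.log ((T : ℝ) ^ 2 / riskLevel δ k)) ≤ regimeUpsilon d T β δ k := by
    unfold regimeUpsilon Upsilon
    rw [div_sq_div_four_eq_riskLevel]
    exact le_max_of_le_right (le_max_left _ _)
  have h2 := pow_le_pow_left₀ (by positivity) h1 2
  rw [mul_pow, Real.sq_sqrt (by positivity)] at h2
  linarith

theorem two_mul_log_le_regimeUpsilon_sq (hT : 1 ≤ T) (hδ : 0 < δ) (hδ1 : δ < 1) (k : ℕ) :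
    2 * T * Real.log (2 * (d + 1) * T / riskLevel δ k) ≤ regimeUpsilon d T β δ k ^ 2 := by
  have h0 := log_div_riskLevel_nonneg (d := d) hT hδ hδ1 k
  have h1 : √(2 * T * Real.log (2 * (d + 1) * T / riskLevel δ k)) ≤ regimeUpsilon d T β δ k := by
    unfold regimeUpsilon Upsilon
    rw [div_sq_div_four_eq_riskLevel]
    exact le_max_of_le_right (le_max_right _ _)
  have h2 := pow_le_pow_left₀ (by positivity) h1 2
  rwa [Real.sq_sqrt (by positivity)] at h2

/-- The logarithm in `Υ` is at least `1`. This lets `(γ Υ)²` absorb the accumulated squared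
gradients `4 d γ² T`. -/
theorem four_mul_le_regimeUpsilon_sq (hT : 1 ≤ T) (hδ : 0 < δ) (hδ1 : δ < 1) (k : ℕ) :
    4 * (d * T : ℝ) ≤ regimeUpsilon d T β δ k ^ 2 := by
  have h0 := log_sq_div_riskLevel_ge_one hT hδ hδ1 k
  have h1 := four_mul_log_le_regimeUpsilon_sq (d := d) (β := β) hT hδ hδ1 k
  have h2 : (0 : ℝ) ≤ d * T := by positivity
  nlinarith

theorem two_mul_sqrt_le_regimeUpsilon (hT : 1 ≤ T) (hδ : 0 < δ) (hδ1 : δ < 1) (k : ℕ) :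
    2 * (√d * √T) ≤ regimeUpsilon d T β δ k := by
  refine le_of_sq_le_sq ?_ (regimeUpsilon_nonneg k)
  rw [mul_pow, mul_pow, Real.sq_sqrt (by positivity), Real.sq_sqrt (by positivity)]
  linarith [four_mul_le_regimeUpsilon_sq (d := d) (β := β) hT hδ hδ1 k]

theorem regimeUpsilon_mono (hT : 1 ≤ T) (hδ : 0 < δ) (hδ1 : δ < 1)
    (hβ : AntitoneOn β (Set.Ioc 0 1)) : Monotone (regimeUpsilon d T β δ) := by
  intro k l hkl
  have hT' : (0 : ℝ) < T := by exact_mod_cast hT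
  have h1 := riskLevel_antitone hδ hkl
  have hk := riskLevel_pos hδ k
  have hl := riskLevel_pos hδ l
  unfold regimeUpsilon Upsilon
  rw [div_sq_div_four_eq_riskLevel, div_sq_div_four_eq_riskLevel]
  refine max_le_max (hβ (riskLevel_mem hδ hδ1 l) (riskLevel_mem hδ hδ1 k) h1)
    (max_le_max ?_ ?_)
  · gcongr
  · gcongr

theorem threshold_mono (hT : 1 ≤ T) (hδ : 0 < δ) (hδ1 : δ < 1)
    (hβ : AntitoneOn β (Set.Ioc 0 1)) : Monotone (threshold d T β δ) := by
  intro k l hkl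
  have := regimeUpsilon_mono (d := d) hT hδ hδ1 hβ hkl
  unfold regimeUpsilon at this
  unfold threshold
  gcongr

/-- Used to absorb terms linear in `γ Υ` into quadratic ones when the radius is verified. -/
theorem two_le_stepSize_mul_regimeUpsilon (hd : 0 < d) (hT : 1 ≤ T) (hδ : 0 < δ) (hδ1 : δ < 1)
    (k : ℕ) : 2 ≤ stepSize T k * regimeUpsilon d T β δ k := by
  have hT' : (0 : ℝ) < √T := Real.sqrt_pos.mpr (by exact_mod_cast hT)
  have hd' : (1 : ℝ) ≤ √d := Real.one_le_sqrt.mpr (by exact_mod_cast hd)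
  have h1 := two_mul_sqrt_le_regimeUpsilon (d := d) (β := β) hT hδ hδ1 k
  have h2 : (1 : ℝ) ≤ 2 ^ k := one_le_pow₀ one_le_two
  unfold stepSize
  rw [div_mul_eq_mul_div, le_div_iff₀ hT']
  nlinarith [regimeUpsilon_nonneg (d := d) (T := T) (β := β) (δ := δ) k]

theorem sum_stepSize_eq (K : ℕ) :
    ∑ k ∈ Finset.range (K + 1), stepSize T k = (2 ^ (K + 1) - 1) / √T := by
  unfold stepSize
  rw [← Finset.sum_div]
  congr 1
  have := geom_sum_eq (x := (2 : ℝ)) (by norm_num) (K + 1)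
  rw [this]
  norm_num

end ConstantBounds

/-! ### Deterministic analysis on the good event: radius, thresholds, costs -/

section GoodEvent

variable {X A : Type*} [MeasurableSpace X] [MeasurableSpace A] {d : ℕ}

/-- Radius around the optimal dual variable (of norm `n`) in which regime `k` remains. -/
def radius (d T : ℕ) (β : ℝ → ℝ) (δ n : ℝ) (k : ℕ) : ℝ :=
  n + 7 * √d * (stepSize T k * regimeUpsilon d T β δ k)

/-- Deviations of the dual integrand from the dual objective, in the rounds of regime `k` where the
dual variable is close to `v`. -/
def gainIncrement (P : Problem X A d) (E : Estimator X A d) (T : ℕ) (β : ℝ → ℝ) (δ : ℝ)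
    (B : Fin d → ℝ) (b : ℝ) (v : Fin d → ℝ) (k : ℕ) (o : ℕ → Obs X A d) (τ : ℕ) : ℝ :=
  if (state E T β δ B b o τ).regime = k ∧
      norm₂ ((state E T β δ B b o τ).lam - v) ≤ radius d T β δ (norm₂ v) k then
    P.gain (shift B b) v (o τ).1 - P.gain (shift B b) (state E T β δ B b o τ).lam (o τ).1
      - (P.dual (shift B b) v - P.dual (shift B b) (state E T β δ B b o τ).lam)
  else 0

/-- Deviations of the costs from their conditional expectations, in the rounds of regime `k`. -/
def costIncrement (P : Problem X A d) (E : Estimator X A d) (T : ℕ) (β : ℝ → ℝ) (δ : ℝ)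
    (B : Fin d → ℝ) (b : ℝ) (i : Fin d) (k : ℕ) (o : ℕ → Obs X A d) (τ : ℕ) : ℝ :=
  if (state E T β δ B b o τ).regime = k then (o τ).2.2.2 i - P.c (o τ).1 (o τ).2.1 i else 0

/-- The event on which the bounds of the meta-strategy hold: accuracy of the estimates and control
of all deviations, in the regimes `k ≤ K`. -/
structure Good (P : Problem X A d) (E : Estimator X A d) (T : ℕ) (β : ℝ → ℝ) (δ : ℝ)
    (B : Fin d → ℝ) (b : ℝ) (v : Fin d → ℝ) (K : ℕ) (o : ℕ → Obs X A d) : Prop where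
  accurate : ∀ k ≤ K, ∀ t ≤ T, Accurate P E t (hist o t) (riskLevel δ k)
  gain_dev : ∀ k ≤ K, ∀ t < T,
    ∑ τ ∈ Finset.range (t + 1), gainIncrement P E T β δ B b v k o τ
      ≤ 3 * regimeUpsilon d T β δ k * radius d T β δ (norm₂ v) k
  cost_dev : ∀ k ≤ K, ∀ t < T, ∀ i,
    ∑ τ ∈ Finset.range (t + 1), costIncrement P E T β δ B b i k o τ
      ≤ 2 * regimeUpsilon d T β δ k
  reward_dev : ∑ τ ∈ Finset.range T, (P.r (o τ).1 (o τ).2.1 - (o τ).2.2.1)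
    ≤ regimeUpsilon d T β δ (ilog T)
  dual_dev : ∑ τ ∈ Finset.range T, (P.dual (shift B b) v - P.gain (shift B b) v (o τ).1)
    ≤ (2 + 4 * √d * norm₂ v) * regimeUpsilon d T β δ (ilog T)

variable {P : Problem X A d} {E : Estimator X A d} {T : ℕ} {β : ℝ → ℝ} {δ : ℝ}
  {B : Fin d → ℝ} {b : ℝ} {v : Fin d → ℝ} {K : ℕ} {o : ℕ → Obs X A d}

/-- Fixed data of the analysis of one trajectory. -/
structure Setup (P : Problem X A d) (E : Estimator X A d) (T : ℕ) (β : ℝ → ℝ) (δ : ℝ)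
    (B : Fin d → ℝ) (b : ℝ) (v : Fin d → ℝ) (K : ℕ) (o : ℕ → Obs X A d) : Prop where
  d_pos : 0 < d
  T_pos : 1 ≤ T
  δ_pos : 0 < δ
  δ_lt : δ < 1
  shift_le : ∀ i, |shift B b i| ≤ 1
  antitone : AntitoneOn β (Set.Ioc 0 1)
  budget : ∀ k, ∑ t ∈ Finset.range T, playErr E δ o k t ≤ β (riskLevel δ k)
  follows : FollowsMeta E T β δ B b o
  optimal : P.IsDualOptimal (shift B b) v
  K_le : K ≤ ilog T
  norm_le : norm₂ v ≤ 2 ^ K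
  card_le : (2 : ℝ) ^ (K + 1) - 1 ≤ max 1 (4 * norm₂ v)
  good : Good P E T β δ B b v K o

namespace Setup

theorem radius_nonneg (h : Setup P E T β δ B b v K o) (k : ℕ) :
    0 ≤ radius d T β δ (norm₂ v) k := by
  have h1 := norm₂_nonneg v
  have h2 := (stepSize_pos h.T_pos k).le
  have h3 := regimeUpsilon_nonneg (d := d) (T := T) (β := β) (δ := δ) k
  unfold radius
  positivity

theorem sum_playErr_le (h : Setup P E T β δ B b v K o) {k : ℕ} (hk : k ≤ K) {t : ℕ} (ht : t ≤ T) :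
    ∑ τ ∈ Finset.range t,
      (if (state E T β δ B b o τ).regime = k then playErr E δ o k τ else 0)
      ≤ regimeUpsilon d T β δ k := by
  have h0 : ∀ τ ∈ Finset.range T, 0 ≤ playErr E δ o k τ := fun τ hτ =>
    (h.good.accurate k hk τ (Finset.mem_range.mp hτ).le).errObs_nonneg _ _
  refine le_trans ?_ ((h.budget k).trans (beta_le_regimeUpsilon k))
  calc _ ≤ ∑ τ ∈ Finset.range t, playErr E δ o k τ := by
        refine Finset.sum_le_sum fun τ hτ => ?_
        split_ifs
        · exact le_rfl
        · exact h0 τ (Finset.range_mono ht hτ)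
    _ ≤ _ := Finset.sum_le_sum_of_subset_of_nonneg (Finset.range_mono ht) fun τ hτ _ => h0 τ hτ

/-- Deviations of the dual integrand in regime `k`, as long as the radius is not exceeded. -/
theorem sum_gain_sub_le (h : Setup P E T β δ B b v K o) {k : ℕ} (hk : k ≤ K) {t : ℕ} (ht : t ≤ T)
    (hr : ∀ τ < t, (state E T β δ B b o τ).regime = k →
      norm₂ ((state E T β δ B b o τ).lam - v) ≤ radius d T β δ (norm₂ v) k) :
    ∑ τ ∈ Finset.range t, (if (state E T β δ B b o τ).regime = k then
      P.gain (shift B b) v (o τ).1 - P.gain (shift B b) (state E T β δ B b o τ).lam (o τ).1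
      else 0) ≤ 3 * regimeUpsilon d T β δ k * radius d T β δ (norm₂ v) k := by
  cases t with
  | zero =>
    have h1 := h.radius_nonneg k
    have h2 := regimeUpsilon_nonneg (d := d) (T := T) (β := β) (δ := δ) k
    simpa using by positivity
  | succ t =>
    refine le_trans (Finset.sum_le_sum fun τ hτ => ?_) (h.good.gain_dev k hk t ht)
    unfold gainIncrement
    by_cases hτk : (state E T β δ B b o τ).regime = k
    · rw [if_pos hτk, if_pos ⟨hτk, hr τ (Finset.mem_range.mp hτ) hτk⟩]
      -- Optimality of `v` makes the subtracted mean nonpositive, so the centered increment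
      -- dominates the raw difference.
      have := h.optimal.2 _ (lam_nonneg E T β δ B b o τ)
      linarith
    · rw [if_neg hτk, if_neg fun hh => hτk hh.1]

/-- Observed costs exceed their lower-confidence versions by a martingale term (at most `2Υ`) and
twice the estimation errors (at most `2Υ`); what remains is the sum of the gradients. -/
theorem excess_le (h : Setup P E T β δ B b v K o) {t : ℕ} (ht : t < T)
    (hk : (state E T β δ B b o t).regime ≤ K) (i : Fin d) :
    excess E T β δ B b o t i
      ≤ (stepSize T (state E T β δ B b o t).regime)⁻¹ * nextLam E T β δ B b o t i
        + 4 * regimeUpsilon d T β δ (state E T β δ B b o t).regime := by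
  set k := (state E T β δ B b o t).regime with hkdef
  have h1 := h.good.cost_dev k hk t ht i
  have h2 := h.sum_playErr_le hk (t := t + 1) ht
  have h3 := (stepSize_mul_sum_grad_le_lam E T β δ B b o t i).2
  rw [← hkdef] at h3
  have h4 := (le_inv_mul_iff₀ (stepSize_pos h.T_pos k)).mpr h3
  rw [excess_apply_eq_sum_ite, ← hkdef]
  have h5 : ∑ τ ∈ Finset.range (t + 1), (if (state E T β δ B b o τ).regime = k
        then (o τ).2.2.2 i - shift B b i else 0)
      ≤ ∑ τ ∈ Finset.range (t + 1), costIncrement P E T β δ B b i k o τ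
        + 2 * (∑ τ ∈ Finset.range (t + 1),
          (if (state E T β δ B b o τ).regime = k then playErr E δ o k τ else 0))
        + ∑ τ ∈ Finset.range (t + 1), (if (state E T β δ B b o τ).regime = k
          then grad E T β δ B b o τ i else 0) := by
    rw [Finset.mul_sum, ← Finset.sum_add_distrib, ← Finset.sum_add_distrib]
    refine Finset.sum_le_sum fun τ hτ => ?_
    have hτ' := Finset.mem_range.mp hτ
    unfold costIncrement
    by_cases hτk : (state E T β δ B b o τ).regime = k
    · rw [if_pos hτk, if_pos hτk, if_pos hτk, if_pos hτk]
      have h6 := (h.good.accurate k hk τ (by omega)).le_cLcb (o τ).1 (o τ).2.1 i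
      have h7 : grad E T β δ B b o τ i
          = E.cLcb (riskLevel δ k) τ (hist o τ) (o τ).1 (o τ).2.1 i - shift B b i := by
        rw [grad, hτk, Pi.sub_apply]
      rw [h7]
      unfold playErr
      linarith
    · simp [if_neg hτk]
  linarith

variable [Fintype A] [Nonempty A]

/-- The self-consistency of the radius: if it holds before `t`, the deviation, estimation and
gradient-noise terms together keep the potential below its square. -/
theorem potential_le (h : Setup P E T β δ B b v K o) {k : ℕ} (hk : k ≤ K) {t : ℕ} (ht : t ≤ T)
    (hr : ∀ τ < t, (state E T β δ B b o τ).regime = k →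
      norm₂ ((state E T β δ B b o τ).lam - v) ≤ radius d T β δ (norm₂ v) k) :
    potential E T β δ B b o k v t ≤ radius d T β δ (norm₂ v) k ^ 2 := by
  set γ := stepSize T k with hγ
  set Υ := regimeUpsilon d T β δ k with hΥ
  set n := norm₂ v with hn
  have hγ0 : 0 < γ := stepSize_pos h.T_pos k
  have hn0 : 0 ≤ n := norm₂_nonneg v
  have hΥ0 : 0 ≤ Υ := regimeUpsilon_nonneg k
  have hq : (1 : ℝ) ≤ √d := Real.one_le_sqrt.mpr (by exact_mod_cast h.d_pos)
  have h1 := h.sum_gain_sub_le hk ht hr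
  have h2 := h.sum_playErr_le hk ht
  rw [← hΥ, ← hn] at h1
  rw [← hΥ] at h2
  have h3 : potential E T β δ B b o k v t ≤ n ^ 2
      + (2 * γ * (∑ τ ∈ Finset.range t, (if (state E T β δ B b o τ).regime = k then
          P.gain (shift B b) v (o τ).1 - P.gain (shift B b) (state E T β δ B b o τ).lam (o τ).1
          else 0))
        + 2 * γ * (2 * (1 + √d * n)) * (∑ τ ∈ Finset.range t,
          (if (state E T β δ B b o τ).regime = k then playErr E δ o k τ else 0))
        + t * (4 * d * γ ^ 2)) := by
    unfold potential
    have h4 : (t : ℝ) * (4 * d * γ ^ 2) = ∑ _τ ∈ Finset.range t, 4 * d * γ ^ 2 := by simp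
    rw [h4, Finset.mul_sum, Finset.mul_sum, ← Finset.sum_add_distrib, ← Finset.sum_add_distrib]
    refine add_le_add_right (Finset.sum_le_sum fun τ hτ => ?_) _
    have hτ' := Finset.mem_range.mp hτ
    by_cases hτk : (state E T β δ B b o τ).regime = k
    · rw [if_pos hτk, if_pos hτk, if_pos hτk]
      have h5 := grad_dotProduct_sub_le h.follows (hτ'.trans_le ht)
        (P := P) (hτk ▸ h.good.accurate k hk τ (hτ'.le.trans ht)) h.optimal.1
      rw [hτk] at h5
      have h6 := mul_le_mul_of_nonneg_left h5 (show 0 ≤ 2 * γ by positivity)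
      rw [← hn] at h6
      linarith
    · rw [if_neg hτk, if_neg hτk, if_neg hτk]
      simp only [mul_zero, zero_add]
      positivity
  have h7 : (t : ℝ) * (4 * d * γ ^ 2) ≤ (γ * Υ) ^ 2 := by
    have h8 := four_mul_le_regimeUpsilon_sq (d := d) (β := β) h.T_pos h.δ_pos h.δ_lt k
    rw [← hΥ] at h8
    have h9 : (t : ℝ) ≤ T := by exact_mod_cast ht
    calc (t : ℝ) * (4 * d * γ ^ 2) ≤ T * (4 * d * γ ^ 2) := by gcongr
      _ = γ ^ 2 * (4 * (d * T)) := by ring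
      _ ≤ γ ^ 2 * Υ ^ 2 := by gcongr
      _ = _ := by ring
  have hz := two_le_stepSize_mul_regimeUpsilon (d := d) (β := β) h.d_pos h.T_pos h.δ_pos h.δ_lt k
  rw [← hγ, ← hΥ] at hz
  have h10 : 2 * γ * (∑ τ ∈ Finset.range t, (if (state E T β δ B b o τ).regime = k then
          P.gain (shift B b) v (o τ).1 - P.gain (shift B b) (state E T β δ B b o τ).lam (o τ).1
          else 0)) ≤ 2 * γ * (3 * Υ * radius d T β δ n k) := by gcongr
  have h11 : 2 * γ * (2 * (1 + √d * n)) * (∑ τ ∈ Finset.range t,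
          (if (state E T β δ B b o τ).regime = k then playErr E δ o k τ else 0))
          ≤ 2 * γ * (2 * (1 + √d * n)) * Υ := by gcongr
  refine (h3.trans (add_le_add_right (add_le_add (add_le_add h10 h11) h7) _)).trans ?_
  have hR : radius d T β δ n k = n + 7 * √d * (γ * Υ) := rfl
  rw [hR]
  set q := √(d : ℝ)
  set z := γ * Υ with hzdef
  have e : n ^ 2 + (2 * γ * (3 * Υ * (n + 7 * q * z)) + 2 * γ * (2 * (1 + q * n)) * Υ + z ^ 2)
      = n ^ 2 + 6 * z * n + 42 * q * z ^ 2 + 4 * z + 4 * q * z * n + z ^ 2 := by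
    rw [hzdef]; ring
  rw [e]
  have hz0 : 0 ≤ z := by linarith
  -- With `z = γΥ ≥ 2` and `q = √d ≥ 1`, the terms beyond `n²` are at most `10 q z n + 45 q² z²`,
  -- while `(n + 7 q z)²` supplies `14 q z n + 49 q² z²`.
  have i1 : z * n ≤ q * (z * n) := le_mul_of_one_le_left (by positivity) hq
  have i2 : q * z ^ 2 ≤ q * (q * z ^ 2) := le_mul_of_one_le_left (by positivity) hq
  have i3 : z ^ 2 ≤ q * z ^ 2 := le_mul_of_one_le_left (by positivity) hq
  have i4 : 2 * z ≤ z ^ 2 := by nlinarith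
  have i5 : 0 ≤ q * (z * n) := by positivity
  nlinarith

theorem norm₂_lam_sub_le (h : Setup P E T β δ B b v K o) {k : ℕ} (hk : k ≤ K) :
    ∀ t ≤ T, (state E T β δ B b o t).regime = k →
      norm₂ ((state E T β δ B b o t).lam - v) ≤ radius d T β δ (norm₂ v) k := by
  intro t
  induction t using Nat.strong_induction_on with
  | _ t ih =>
    intro ht htk
    have h1 := h.potential_le hk ht fun τ hτ hτk => ih τ hτ (hτ.le.trans ht) hτk
    have h2 := (potential_bounds E T β δ B b o h.optimal.1
      (norm₂_grad_sq_le E T β δ h.shift_le o) k t).2 htk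
    exact le_of_sq_le_sq (h2.1.trans h1) (h.radius_nonneg k)

/-- Holds even for a step that a regime switch would discard; otherwise it could not be used to rule
the switch out. -/
theorem norm₂_nextLam_sub_le (h : Setup P E T β δ B b v K o) {k : ℕ} (hk : k ≤ K) {t : ℕ}
    (ht : t < T) (htk : (state E T β δ B b o t).regime = k) :
    norm₂ (nextLam E T β δ B b o t - v) ≤ radius d T β δ (norm₂ v) k := by
  have h1 := h.potential_le hk (t := t + 1) ht fun τ hτ hτk =>
    h.norm₂_lam_sub_le hk τ (by omega) hτk
  have h2 := (potential_bounds E T β δ B b o h.optimal.1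
    (norm₂_grad_sq_le E T β δ h.shift_le o) k t).2 htk
  exact le_of_sq_le_sq (h2.2.trans h1) (h.radius_nonneg k)

/-- The regime that is adapted to the optimal dual variable is not interrupted. -/
theorem norm₂_excess_le_threshold (h : Setup P E T β δ B b v K o) {t : ℕ} (ht : t < T)
    (hk : (state E T β δ B b o t).regime = K) :
    norm₂ (excess E T β δ B b o t)⁺ ≤ threshold d T β δ K := by
  set γ := stepSize T K with hγ
  set Υ := regimeUpsilon d T β δ K with hΥ
  have hγ0 : 0 < γ := stepSize_pos h.T_pos K
  have hΥ0 : 0 ≤ Υ := regimeUpsilon_nonneg K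
  have hT' : (0 : ℝ) < √T := Real.sqrt_pos.mpr (by exact_mod_cast h.T_pos)
  have h1 : norm₂ (excess E T β δ B b o t)⁺
      ≤ norm₂ (γ⁻¹ • nextLam E T β δ B b o t + fun _ => 4 * Υ) := by
    refine norm₂_le_of_abs_le fun i => ?_
    have h2 := h.excess_le ht hk.le i
    rw [hk] at h2
    have h3 : 0 ≤ nextLam E T β δ B b o t i := nextLam_nonneg E T β δ B b o t i
    have h4 : 0 ≤ γ⁻¹ * nextLam E T β δ B b o t i + 4 * Υ := by positivity
    rw [Pi.posPart_apply, abs_of_nonneg (posPart_nonneg _), Pi.add_apply, Pi.smul_apply,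
      smul_eq_mul, abs_of_nonneg h4]
    exact sup_le h2 h4
  have h2 : norm₂ (fun _ : Fin d => 4 * Υ) ≤ √d * (4 * Υ) :=
    norm₂_le_sqrt_mul (by positivity) fun i => by rw [abs_of_nonneg (by positivity)]
  have h3 : norm₂ (nextLam E T β δ B b o t)
      ≤ 2 * norm₂ v + 7 * √d * (γ * Υ) := by
    have h4 := h.norm₂_nextLam_sub_le le_rfl ht hk
    have h5 := norm₂_add_le (nextLam E T β δ B b o t - v) v
    rw [sub_add_cancel] at h5
    unfold radius at h4
    rw [← hγ, ← hΥ] at h4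
    linarith
  -- This is where `K` is adapted to `v`: `γ_K = 2 ^ K / √T` and `‖v‖ ≤ 2 ^ K`. The excess is then
  -- at most `2√T + 11√d Υ`, below the threshold.
  have h4 : γ⁻¹ * norm₂ v ≤ √T := by
    rw [inv_mul_le_iff₀ hγ0, hγ, stepSize, div_mul_cancel₀ _ hT'.ne']
    exact h.norm_le
  have h5 := norm₂_add_le (γ⁻¹ • nextLam E T β δ B b o t) fun _ => 4 * Υ
  rw [norm₂_smul, abs_of_pos (inv_pos.mpr hγ0)] at h5
  have h6 : γ⁻¹ * norm₂ (nextLam E T β δ B b o t) ≤ 2 * √T + 7 * √d * Υ := by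
    calc _ ≤ γ⁻¹ * (2 * norm₂ v + 7 * √d * (γ * Υ)) :=
          mul_le_mul_of_nonneg_left h3 (inv_pos.mpr hγ0).le
      _ = 2 * (γ⁻¹ * norm₂ v) + 7 * √d * Υ := by field_simp
      _ ≤ _ := by linarith
  have h7 : threshold d T β δ K = 4 * √T + 20 * √d * Υ := rfl
  have h8 : 0 ≤ √d * Υ := by positivity
  rw [h7]
  linarith

/-- Regimes increase one at a time, and the adapted one never triggers the switching test. -/
theorem regime_le (h : Setup P E T β δ B b v K o) :
    ∀ t ≤ T, (state E T β δ B b o t).regime ≤ K := by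
  intro t
  induction t with
  | zero => intro _; exact Nat.zero_le _
  | succ t ih =>
    intro ht
    have ih' := ih (by omega)
    rcases lt_or_ge (threshold d T β δ (state E T β δ B b o t).regime)
      (norm₂ (excess E T β δ B b o t)⁺) with h1 | h1
    · rw [state_succ_of_lt E T β δ B b o h1]
      rcases ih'.lt_or_eq with h2 | h2
      · exact h2
      · have h3 := h.norm₂_excess_le_threshold ht h2
        rw [h2] at h1
        exact absurd h1 (not_lt.mpr h3)
    · rw [state_succ_of_le E T β δ B b o h1]
      exact ih'

/-- Control of the costs over all past regimes, and over the current one. -/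
theorem sum_cost_sub_le (h : Setup P E T β δ B b v K o) (hc : ∀ t < T, ∀ i, (o t).2.2.2 i ≤ 1)
    (i : Fin d) : ∀ t ≤ T,
    (∑ τ ∈ Finset.range (state E T β δ B b o t).start, ((o τ).2.2.2 i - shift B b i)
      ≤ (state E T β δ B b o t).regime * (threshold d T β δ (ilog T) + 2 * √d)) ∧
    ∑ τ ∈ Finset.Ico (state E T β δ B b o t).start t, ((o τ).2.2.2 i - shift B b i)
      ≤ threshold d T β δ (ilog T) := by
  have hM : ∀ k ≤ K, threshold d T β δ k ≤ threshold d T β δ (ilog T) := fun k hk =>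
    threshold_mono h.T_pos h.δ_pos h.δ_lt h.antitone (hk.trans h.K_le)
  have hM0 : 0 ≤ threshold d T β δ (ilog T) := by
    have := regimeUpsilon_nonneg (d := d) (T := T) (β := β) (δ := δ) (ilog T)
    unfold regimeUpsilon at this
    unfold threshold
    positivity
  have hq : (1 : ℝ) ≤ √d := Real.one_le_sqrt.mpr (by exact_mod_cast h.d_pos)
  intro t
  induction t with
  | zero => intro _; simpa [state] using hM0
  | succ t ih =>
    intro ht
    obtain ⟨ih1, ih2⟩ := ih (by omega)
    have hst := start_le E T β δ B b o t
    rcases lt_or_ge (threshold d T β δ (state E T β δ B b o t).regime)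
      (norm₂ (excess E T β δ B b o t)⁺) with h1 | h1
    · rw [state_succ_of_lt E T β δ B b o h1]
      refine ⟨?_, by simpa using hM0⟩
      -- The round that triggers the switch may overshoot the threshold; before it, the excess was
      -- within bounds.
      have h2 : (o t).2.2.2 i - shift B b i ≤ 2 * √d := by
        have := abs_le.mp (h.shift_le i)
        linarith [hc t ht i]
      rw [Finset.sum_range_succ, ← Finset.sum_range_add_sum_Ico _ hst]
      push_cast
      linarith
    · rw [state_succ_of_le E T β δ B b o h1]
      refine ⟨ih1, ?_⟩
      simp only
      rw [← excess_apply]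
      refine (le_posPart (excess E T β δ B b o t) i).trans ((le_abs_self _).trans ?_)
      exact (abs_le_norm₂ _ i).trans (h1.trans (hM _ (h.regime_le t (by omega))))

/-- The margin is defined so that `T b` equals the largest total excess of `1 + ilog T` regimes. -/
theorem sum_cost_le (h : Setup P E T β δ B b v K o) (hc : ∀ t < T, ∀ i, (o t).2.2.2 i ≤ 1)
    (hb : b = margin d T β δ) (i : Fin d) :
    ∑ t ∈ Finset.range T, (o t).2.2.2 i ≤ T * B i := by
  obtain ⟨h1, h2⟩ := h.sum_cost_sub_le hc i T le_rfl
  have h3 : ((state E T β δ B b o T).regime : ℝ) ≤ ilog T := by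
    exact_mod_cast (h.regime_le T le_rfl).trans h.K_le
  have h4 := Finset.sum_range_add_sum_Ico (fun τ => (o τ).2.2.2 i - shift B b i)
    (start_le E T β δ B b o T)
  have hM0 : 0 ≤ threshold d T β δ (ilog T) := by
    have := regimeUpsilon_nonneg (d := d) (T := T) (β := β) (δ := δ) (ilog T)
    unfold regimeUpsilon at this
    unfold threshold
    positivity
  have hT' : (0 : ℝ) < T := by exact_mod_cast h.T_pos
  have h5 : T * b = (1 + (ilog T : ℝ)) * (threshold d T β δ (ilog T) + 2 * √d) := by
    rw [hb, margin]; field_simp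
  have h6 : ((state E T β δ B b o T).regime : ℝ) * (threshold d T β δ (ilog T) + 2 * √d)
      ≤ ilog T * (threshold d T β δ (ilog T) + 2 * √d) := by gcongr
  have h7 : 0 ≤ √(d : ℝ) := Real.sqrt_nonneg _
  have h8 : ∑ τ ∈ Finset.range T, ((o τ).2.2.2 i - shift B b i)
      = ∑ τ ∈ Finset.range T, (o τ).2.2.2 i - T * (B i - b) := by
    simp [Finset.sum_sub_distrib, shift, mul_sub]
  linarith

end Setup

end GoodEvent

/-! ### Regret on the good event -/

section Regret

variable {X A : Type*} [MeasurableSpace X] [MeasurableSpace A] [Fintype A] [Nonempty A] {d : ℕ}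
  {P : Problem X A d} {E : Estimator X A d} {T : ℕ} {β : ℝ → ℝ} {δ : ℝ}
  {B : Fin d → ℝ} {b : ℝ} {v : Fin d → ℝ} {K : ℕ} {o : ℕ → Obs X A d}

/-- Collects the error terms of all regimes. -/
theorem regime_arithmetic {n U q m W k l : ℝ} (hn0 : 0 ≤ n) (hU0 : 0 ≤ U) (hq : 1 ≤ q)
    (hm1 : 1 ≤ m) (hm2 : 4 * n ≤ m) (hW0 : 0 ≤ W) (hWU : 2 * (q * U) ≤ W) (hk : k ≤ l)
    (hkm : k + 1 ≤ m) :
    (2 + 4 * q * n) * U + ((k + 1) * (3 * U * n + 2 * U) + (21 * (q * (m * W)) + m * W / 2)) + U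
      ≤ 36 * m * q * W + n * (3 * U * l) := by
  have hmU : 0 ≤ m * U := by positivity
  have hmW : 0 ≤ m * W := by positivity
  have i1 : m * (2 * (q * U)) ≤ m * W := mul_le_mul_of_nonneg_left hWU (by linarith)
  have i2 : m * W ≤ q * (m * W) := le_mul_of_one_le_left hmW hq
  have i3 : m * U ≤ q * (m * U) := le_mul_of_one_le_left hmU hq
  have i4 : 4 * n * U ≤ m * U := by gcongr
  have i5 : U ≤ m * U := le_mul_of_one_le_left hU0 hm1
  have i6 : q * U * (4 * n) ≤ q * U * m := by gcongr
  have i7 : (k + 1) * (2 * U) ≤ m * (2 * U) := by gcongr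
  have i8 : k * (3 * U * n) ≤ l * (3 * U * n) := by gcongr
  linarith

namespace Setup

/-- Loss with respect to the optimal dual variable, over regime `k`. -/
theorem sum_gain_sub_reward_le (h : Setup P E T β δ B b v K o) {k : ℕ} (hk : k ≤ K) :
    ∑ τ ∈ Finset.range T, (if (state E T β δ B b o τ).regime = k then
      P.gain (shift B b) v (o τ).1 - P.r (o τ).1 (o τ).2.1 else 0)
      ≤ 3 * regimeUpsilon d T β δ k * radius d T β δ (norm₂ v) k + 2 * d * stepSize T k * T
        + 2 * regimeUpsilon d T β δ k := by
  set γ := stepSize T k with hγ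
  have hγ0 : 0 < γ := stepSize_pos h.T_pos k
  have h1 := h.sum_gain_sub_le hk le_rfl fun τ hτ => h.norm₂_lam_sub_le hk τ hτ.le
  have h2 := h.sum_playErr_le hk le_rfl
  have h3 : - ∑ τ ∈ Finset.range T, (if (state E T β δ B b o τ).regime = k then
      grad E T β δ B b o τ ⬝ᵥ (state E T β δ B b o τ).lam else 0) ≤ 2 * d * γ * T := by
    -- Comparison with the point `0`: that potential starts at `0` and stays nonnegative, so `2γ ∑
    -- ⟨g, λ⟩ + 4dγ²T ≥ 0`, which bounds the sum from below.
    have h4 := (potential_bounds E T β δ B b o (le_refl 0)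
      (norm₂_grad_sq_le E T β δ h.shift_le o) k T).1
    have h5 : potential E T β δ B b o k 0 T ≤ 2 * γ * (∑ τ ∈ Finset.range T,
        (if (state E T β δ B b o τ).regime = k then
          grad E T β δ B b o τ ⬝ᵥ (state E T β δ B b o τ).lam else 0)) + T * (4 * d * γ ^ 2) := by
      have h6 : (T : ℝ) * (4 * d * γ ^ 2) = ∑ _τ ∈ Finset.range T, 4 * d * γ ^ 2 := by simp
      unfold potential
      rw [norm₂_zero, h6, Finset.mul_sum, ← Finset.sum_add_distrib]
      simp only [ne_eq, OfNat.ofNat_ne_zero, not_false_eq_true, zero_pow, zero_add, sub_zero]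
      refine Finset.sum_le_sum fun τ _ => ?_
      split_ifs
      · exact le_rfl
      · rw [mul_zero, zero_add]; positivity
    have h7 : 0 ≤ γ * (2 * (∑ τ ∈ Finset.range T,
        (if (state E T β δ B b o τ).regime = k then
          grad E T β δ B b o τ ⬝ᵥ (state E T β δ B b o τ).lam else 0)) + T * (4 * d * γ)) := by
      linarith
    have h8 := (mul_nonneg_iff_of_pos_left hγ0).mp h7
    linarith
  have h4 : ∑ τ ∈ Finset.range T, (if (state E T β δ B b o τ).regime = k then
      P.gain (shift B b) v (o τ).1 - P.r (o τ).1 (o τ).2.1 else 0)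
      ≤ ∑ τ ∈ Finset.range T, (if (state E T β δ B b o τ).regime = k then
      P.gain (shift B b) v (o τ).1 - P.gain (shift B b) (state E T β δ B b o τ).lam (o τ).1
      else 0) + -∑ τ ∈ Finset.range T, (if (state E T β δ B b o τ).regime = k then
      grad E T β δ B b o τ ⬝ᵥ (state E T β δ B b o τ).lam else 0)
      + 2 * ∑ τ ∈ Finset.range T,
      (if (state E T β δ B b o τ).regime = k then playErr E δ o k τ else 0) := by
    rw [Finset.mul_sum, ← Finset.sum_neg_distrib, ← Finset.sum_add_distrib,
      ← Finset.sum_add_distrib]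
    refine Finset.sum_le_sum fun τ hτ => ?_
    have hτ' := Finset.mem_range.mp hτ
    by_cases hτk : (state E T β δ B b o τ).regime = k
    · simp only [if_pos hτk]
      have h5 := gain_add_grad_le_reward h.follows hτ'
        (P := P) (hτk ▸ h.good.accurate k hk τ hτ'.le)
      rw [hτk] at h5
      linarith
    · simp [if_neg hτk]
  linarith

theorem sum_eq_sum_regimes (h : Setup P E T β δ B b v K o) (f : ℕ → ℝ) :
    ∑ τ ∈ Finset.range T, f τ = ∑ k ∈ Finset.range (K + 1), ∑ τ ∈ Finset.range T,
      (if (state E T β δ B b o τ).regime = k then f τ else 0) := by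
  rw [Finset.sum_comm]
  refine Finset.sum_congr rfl fun τ hτ => ?_
  rw [Finset.sum_ite_eq, if_pos]
  exact Finset.mem_range.mpr (Nat.lt_succ_iff.mpr (h.regime_le τ (Finset.mem_range.mp hτ).le))

/-- Three sources of loss: context noise in the dual integrand at `v`, the suboptimality of the play
in each regime, and reward noise. All `Υ_k` are replaced by the largest, at `ilog T`; the remaining
dependence on `k` is through the geometric step sizes. -/
theorem dual_sub_reward_le (h : Setup P E T β δ B b v K o) :
    T * P.dual (shift B b) v - ∑ τ ∈ Finset.range T, (o τ).2.2.1
      ≤ 36 * max 1 (4 * norm₂ v) * √d * (regimeUpsilon d T β δ (ilog T) ^ 2 / √T)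
        + norm₂ v * (6 * regimeUpsilon d T β δ (ilog T) * ilog T) := by
  set U := regimeUpsilon d T β δ (ilog T) with hU
  set n := norm₂ v with hn
  set m := max 1 (4 * n) with hm
  set q := √(d : ℝ) with hqdef
  set S := √(T : ℝ) with hSdef
  have hn0 : 0 ≤ n := norm₂_nonneg v
  have hU0 : 0 ≤ U := regimeUpsilon_nonneg _
  have hq : 1 ≤ q := Real.one_le_sqrt.mpr (by exact_mod_cast h.d_pos)
  have hS : 0 < S := Real.sqrt_pos.mpr (by exact_mod_cast h.T_pos)
  have hm1 : 1 ≤ m := le_max_left _ _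
  have hm2 : 4 * n ≤ m := le_max_right _ _
  have hUS : 2 * (q * S) ≤ U := two_mul_sqrt_le_regimeUpsilon h.T_pos h.δ_pos h.δ_lt _
  set W := U ^ 2 / S with hW
  have hW0 : 0 ≤ W := by positivity
  have hWU : 2 * (q * U) ≤ W := by
    rw [hW, le_div_iff₀ hS]; nlinarith
  have hK : (K : ℝ) ≤ ilog T := by exact_mod_cast h.K_le
  -- Bounds the number of regimes by `m`, so the `Υ` terms paid once per regime fit into the leading
  -- term.
  have hKm : (K : ℝ) + 1 ≤ m := by
    refine le_trans ?_ h.card_le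
    have h1 : K + 1 < 2 ^ (K + 1) := Nat.lt_two_pow_self
    have h2 : ((K + 1 + 1 : ℕ) : ℝ) ≤ ((2 ^ (K + 1) : ℕ) : ℝ) := by exact_mod_cast h1
    push_cast at h2
    linarith
  have hreg : ∀ k ∈ Finset.range (K + 1), ∑ τ ∈ Finset.range T,
      (if (state E T β δ B b o τ).regime = k then
        P.gain (shift B b) v (o τ).1 - P.r (o τ).1 (o τ).2.1 else 0)
      ≤ (3 * U * n + 2 * U) + (21 * q * U ^ 2 + 2 * d * T) * stepSize T k := by
    intro k hk
    have hk' : k ≤ K := Nat.lt_succ_iff.mp (Finset.mem_range.mp hk)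
    refine (h.sum_gain_sub_reward_le hk').trans ?_
    have hUk : regimeUpsilon d T β δ k ≤ U :=
      regimeUpsilon_mono h.T_pos h.δ_pos h.δ_lt h.antitone (hk'.trans h.K_le)
    have hUk0 : 0 ≤ regimeUpsilon d T β δ k := regimeUpsilon_nonneg k
    have hγ := (stepSize_pos h.T_pos k).le
    have h1 : 3 * regimeUpsilon d T β δ k * radius d T β δ n k
        ≤ 3 * U * (n + 7 * q * (stepSize T k * U)) := by
      unfold radius
      gcongr
    calc _ ≤ 3 * U * (n + 7 * q * (stepSize T k * U)) + 2 * d * stepSize T k * T + 2 * U := by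
          gcongr
      _ = _ := by ring
  have hsum : ∑ τ ∈ Finset.range T, (P.gain (shift B b) v (o τ).1 - P.r (o τ).1 (o τ).2.1)
      ≤ (K + 1) * (3 * U * n + 2 * U) + (21 * q * U ^ 2 + 2 * d * T) * (m / S) := by
    rw [h.sum_eq_sum_regimes]
    refine (Finset.sum_le_sum hreg).trans ?_
    rw [Finset.sum_add_distrib, ← Finset.mul_sum, sum_stepSize_eq]
    simp only [Finset.sum_const, Finset.card_range, nsmul_eq_mul]
    push_cast
    have := h.card_le
    gcongr
  have h1 := h.good.reward_dev
  have h2 := h.good.dual_dev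
  have h3 : T * P.dual (shift B b) v - ∑ τ ∈ Finset.range T, (o τ).2.2.1
      = ∑ τ ∈ Finset.range T, (P.dual (shift B b) v - P.gain (shift B b) v (o τ).1)
        + ∑ τ ∈ Finset.range T, (P.gain (shift B b) v (o τ).1 - P.r (o τ).1 (o τ).2.1)
        + ∑ τ ∈ Finset.range T, (P.r (o τ).1 (o τ).2.1 - (o τ).2.2.1) := by
    simp only [Finset.sum_sub_distrib, Finset.sum_const, Finset.card_range, nsmul_eq_mul]
    ring
  rw [h3]
  have h4 : (21 * q * U ^ 2 + 2 * d * T) * (m / S) ≤ 21 * (q * (m * W)) + m * W / 2 := by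
    have h5 : (21 * q * U ^ 2 + 2 * d * T) * (m / S)
        = 21 * (q * (m * W)) + m * (2 * d * T / S) := by
      rw [hW]; field_simp
    have h6 : 2 * d * T / S ≤ W / 2 := by
      rw [hW, div_div, div_le_div_iff₀ hS (by positivity)]
      have h7 := four_mul_le_regimeUpsilon_sq (d := d) (β := β) h.T_pos h.δ_pos h.δ_lt (ilog T)
      rw [← hU] at h7
      nlinarith
    rw [h5]
    nlinarith
  have i9 : 0 ≤ n * (3 * U * ilog T) := by positivity
  linarith [regime_arithmetic hn0 hU0 hq hm1 hm2 hW0 hWU hK hKm]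

/-- Weak duality at the relaxed budget converts the dual value into `opt`, at price `T b √d ‖v‖`.
The logarithmic term of `regretBound` is only nonnegative slack here. -/
theorem regret_le_regretBound (h : Setup P E T β δ B b v K o) (hb : b = margin d T β δ)
    (hb0 : 0 ≤ b) (hf : P.Feasible B) :
    regret P B T o ≤ regretBound d T β δ (norm₂ v) := by
  have h1 := h.dual_sub_reward_le
  have h2 := P.opt_le_dual_shift_add hb0 h.shift_le hf h.optimal.1
  have h3 := mul_le_mul_of_nonneg_left h2 (Nat.cast_nonneg (α := ℝ) T)
  have h4 := log_sq_div_riskLevel_ge_one h.T_pos h.δ_pos h.δ_lt (ilog T)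
  have h5 : 0 ≤ 8 * Real.log ((T : ℝ) ^ 2 / (δ / (4 * (2 + (ilog T : ℝ)) ^ 2))) * ilog T := by
    unfold riskLevel at h4
    rw [add_comm (2 : ℝ)]
    have : (0 : ℝ) ≤ ilog T := Nat.cast_nonneg _
    nlinarith
  have h6 : Upsilon d T β (δ / (2 + (ilog T : ℝ)) ^ 2) = regimeUpsilon d T β δ (ilog T) := by
    rw [regimeUpsilon, add_comm (2 : ℝ)]
  unfold regret regretBound
  simp only [h6]
  rw [← hb]
  nlinarith

end Setup

end Regret

/-! ### Measurability of the state and of the increments -/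

section Measurability

variable {Ω X A : Type*} [mΩ : MeasurableSpace Ω] [MeasurableSpace X] [MeasurableSpace A] {d : ℕ}

theorem Problem.measurable_r [MeasurableSingletonClass A] [Fintype A] (P : Problem X A d) :
    Measurable fun q : X × A => P.r q.1 q.2 :=
  measurable_from_prod_countable_left fun a => P.r_meas a

theorem Problem.measurable_c [MeasurableSingletonClass A] [Fintype A] (P : Problem X A d)
    (i : Fin d) : Measurable fun q : X × A => P.c q.1 q.2 i :=
  measurable_from_prod_countable_left fun a => measurable_pi_iff.mp (P.c_meas a) i

theorem measurable_norm₂ : Measurable (norm₂ : (Fin d → ℝ) → ℝ) := continuous_norm₂.measurable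

theorem measurable_posPart_pi : Measurable fun v : Fin d → ℝ => v⁺ :=
  measurable_pi_iff.mpr fun i => by
    simp only [Pi.posPart_apply, posPart_def]
    exact (measurable_pi_apply i).sup_const 0

variable (E : Estimator X A d) (T : ℕ) (β : ℝ → ℝ) (δ : ℝ) (B : Fin d → ℝ) (b : ℝ)
  {o : ℕ → Ω → Obs X A d}

theorem measurable_cLcb (δ' : ℝ) {t : ℕ} (ho : ∀ s < t + 1, Measurable (o s)) :
    Measurable fun ω => E.cLcb δ' t (hist (fun s => o s ω) t) (o t ω).1 (o t ω).2.1 := by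
  have hh : Measurable fun ω => hist (fun s => o s ω) t :=
    measurable_pi_iff.mpr fun s => ho s (s.2.trans (Nat.lt_succ_self t))
  have ht := ho t (Nat.lt_succ_self t)
  have hxa : Measurable fun ω => ((o t ω).1, (o t ω).2.1) := ht.fst.prodMk ht.snd.fst
  refine measurable_pi_iff.mpr fun i => ?_
  unfold Estimator.cLcb clip Estimator.errObs
  refine Measurable.min (Measurable.max (Measurable.sub ?_ ?_) measurable_const) measurable_const
  · exact (measurable_pi_iff.mp (E.cHat_meas t) i).comp (hh.prodMk hxa)
  · refine (E.err_meas t δ').comp (Measurable.prodMk ?_ hxa)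
    exact measurable_pi_iff.mpr fun s =>
      (measurable_pi_iff.mp hh s).fst.prodMk (measurable_pi_iff.mp hh s).snd.fst

/-- The σ-algebra on `Ω` is left free, so that this applies to each σ-algebra of the filtrations and
yields predictability. -/
theorem measurable_state (t : ℕ) (ho : ∀ s < t, Measurable (o s)) :
    (Measurable fun ω => (state E T β δ B b (fun s => o s ω) t).regime) ∧
    (Measurable fun ω => (state E T β δ B b (fun s => o s ω) t).start) ∧
    (Measurable fun ω => (state E T β δ B b (fun s => o s ω) t).lam) := by
  induction t with
  | zero => exact ⟨measurable_const, measurable_const, measurable_const⟩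
  | succ t ih =>
    obtain ⟨h1, h2, h3⟩ := ih fun s hs => ho s (hs.trans (Nat.lt_succ_self t))
    have hexc : Measurable fun ω => excess E T β δ B b (fun s => o s ω) t := by
      refine measurable_pi_iff.mpr fun i => ?_
      have e : (fun ω => excess E T β δ B b (fun s => o s ω) t i) = fun ω =>
          ∑ τ ∈ Finset.range (t + 1),
            if (state E T β δ B b (fun s => o s ω) t).start ≤ τ
              then (o τ ω).2.2.2 i - shift B b i else 0 := by
        funext ω
        rw [excess_apply, ← Finset.sum_filter]
        refine Finset.sum_congr ?_ fun _ _ => rfl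
        ext τ
        simp only [Finset.mem_Ico, Finset.mem_filter, Finset.mem_range, and_comm]
      rw [e]
      refine Finset.measurable_sum _ fun τ hτ => ?_
      refine Measurable.ite (h2 measurableSet_Iic) ?_ measurable_const
      exact (measurable_pi_iff.mp (ho τ (Finset.mem_range.mp hτ)).snd.snd.snd i).sub
        measurable_const
    have hcond : MeasurableSet {ω | threshold d T β δ
        (state E T β δ B b (fun s => o s ω) t).regime
          < norm₂ (excess E T β δ B b (fun s => o s ω) t)⁺} :=
      measurableSet_lt ((measurable_from_top (f := threshold d T β δ)).comp h1)
        (measurable_norm₂.comp (measurable_posPart_pi.comp hexc))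
    have hnext : Measurable fun ω => nextLam E T β δ B b (fun s => o s ω) t := by
      refine measurable_posPart_pi.comp (h3.add ?_)
      -- The risk level depends on the random regime, while the error functions are measurable only
      -- at a fixed level; countability of the regimes bridges the gap.
      have hgrad : Measurable fun q : ℕ × Ω => stepSize T q.1 •
          (E.cLcb (riskLevel δ q.1) t (hist (fun s => o s q.2) t) (o t q.2).1 (o t q.2).2.1
            - shift B b) :=
        measurable_from_prod_countable_right fun k =>
          ((measurable_cLcb E (riskLevel δ k) ho).sub_const (shift B b)).const_smul (stepSize T k)
      exact hgrad.comp (h1.prodMk measurable_id)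
    have e : ∀ ω, state E T β δ B b (fun s => o s ω) (t + 1)
        = if threshold d T β δ (state E T β δ B b (fun s => o s ω) t).regime
            < norm₂ (excess E T β δ B b (fun s => o s ω) t)⁺
          then ⟨(state E T β δ B b (fun s => o s ω) t).regime + 1, t + 1, 0⟩
          else ⟨(state E T β δ B b (fun s => o s ω) t).regime,
            (state E T β δ B b (fun s => o s ω) t).start,
            nextLam E T β δ B b (fun s => o s ω) t⟩ := fun _ => rfl
    refine ⟨?_, ?_, ?_⟩
    · simp only [e, apply_ite State.regime]
      exact Measurable.ite hcond (measurable_from_top.comp h1) h1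
    · simp only [e, apply_ite State.start]
      exact Measurable.ite hcond measurable_const h2
    · simp only [e, apply_ite State.lam]
      exact Measurable.ite hcond measurable_const hnext

theorem measurableSet_regime_eq (k t : ℕ) (ho : ∀ s < t, Measurable (o s)) :
    MeasurableSet {ω | (state E T β δ B b (fun s => o s ω) t).regime = k} :=
  (measurable_state E T β δ B b t ho).1 (measurableSet_singleton k)

variable [Fintype A] (P : Problem X A d)

theorem measurable_costIncrement [MeasurableSingletonClass A] (i : Fin d) (k t : ℕ)
    (ho : ∀ s < t + 1, Measurable (o s)) :
    Measurable fun ω => costIncrement P E T β δ B b i k (fun s => o s ω) t := by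
  have ht := ho t (Nat.lt_succ_self t)
  refine Measurable.ite (measurableSet_regime_eq E T β δ B b k t
    fun s hs => ho s (hs.trans (Nat.lt_succ_self t))) (Measurable.sub ?_ ?_) measurable_const
  · exact measurable_pi_iff.mp ht.snd.snd.snd i
  · exact (P.measurable_c i).comp (ht.fst.prodMk ht.snd.fst)

theorem measurable_gainIncrement [Nonempty A] (hB : ∀ i, |shift B b i| ≤ 1) (v : Fin d → ℝ)
    (k t : ℕ) (ho : ∀ s < t + 1, Measurable (o s)) :
    Measurable fun ω => gainIncrement P E T β δ B b v k (fun s => o s ω) t := by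
  have ht := ho t (Nat.lt_succ_self t)
  have ho' : ∀ s < t, Measurable (o s) := fun s hs => ho s (hs.trans (Nat.lt_succ_self t))
  have hlam := (measurable_state E T β δ B b t ho').2.2
  refine Measurable.ite ?_ ?_ measurable_const
  · exact (measurableSet_regime_eq E T β δ B b k t ho').inter
      (measurableSet_le (measurable_norm₂.comp (hlam.sub_const v)) measurable_const)
  · refine Measurable.sub (Measurable.sub ?_ ?_) (measurable_const.sub ?_)
    · exact (P.measurable_gain_right _ v).comp ht.fst
    · exact (P.measurable_gain _).comp (hlam.prodMk ht.fst)
    · exact (P.continuous_dual hB).measurable.comp hlam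

end Measurability

/-! ### The interleaved σ-algebras of past and play -/

section Filtration

variable {Ω X A : Type*} [MeasurableSpace X] [MeasurableSpace A] {d : ℕ}
  {o : ℕ → Ω → Obs X A d}

theorem measurable_pastSigma {s t : ℕ} (h : s < t) : Measurable[pastSigma o t] (o s) :=
  measurable_iff_comap_le.mpr (le_iSup₂_of_le s h le_rfl)

theorem pastSigma_le [mΩ : MeasurableSpace Ω] (ho : ∀ t, Measurable (o t)) (t : ℕ) :
    pastSigma o t ≤ mΩ :=
  iSup₂_le fun s _ => measurable_iff_comap_le.mp (ho s)

theorem pastSigma_mono : Monotone (pastSigma o) := fun _ _ h =>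
  iSup₂_le fun s hs => le_iSup₂_of_le s (hs.trans_le h) le_rfl

theorem playSigma_le_pastSigma_succ (t : ℕ) : playSigma o t ≤ pastSigma o (t + 1) := by
  refine sup_le (pastSigma_mono (Nat.le_succ t)) (measurable_iff_comap_le.mp ?_)
  have h := measurable_pastSigma (o := o) (Nat.lt_succ_self t)
  exact (measurable_fst.comp h).prodMk (measurable_fst.comp (measurable_snd.comp h))

theorem playSigma_le [mΩ : MeasurableSpace Ω] (ho : ∀ t, Measurable (o t)) (t : ℕ) :
    playSigma o t ≤ mΩ :=
  (playSigma_le_pastSigma_succ t).trans (pastSigma_le ho _)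

theorem pastSigma_le_playSigma (t : ℕ) : pastSigma o t ≤ playSigma o t := le_sup_left

theorem playSigma_mono : Monotone (playSigma o) :=
  monotone_nat_of_le_succ fun t =>
    (playSigma_le_pastSigma_succ t).trans (pastSigma_le_playSigma (t + 1))

end Filtration

/-! ### Probability of each deviation -/

section Deviations

variable {Ω X A : Type*} [mΩ : MeasurableSpace Ω] [MeasurableSpace X] [MeasurableSpace A]
  {d : ℕ} {μ : Measure Ω} {P : Problem X A d} {T : ℕ} {o : ℕ → Ω → Obs X A d}
  {β : ℝ → ℝ} {δ : ℝ}

theorem exp_neg_log_div {a c : ℝ} (ha : 0 < a) (hc : 0 < c) :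
    Real.exp (-Real.log (a / c)) = c / a := by
  rw [Real.exp_neg, Real.exp_log (div_pos ha hc), inv_div]

namespace IsInteraction

theorem abs_cost_sub_le (hI : IsInteraction P μ T o) {t : ℕ} (ht : t < T) (ω : Ω) (i : Fin d) :
    |(o t ω).2.2.2 i - P.c (o t ω).1 (o t ω).2.1 i| ≤ 2 := by
  have h1 := hI.cost_mem t ht ω i
  have h2 := P.c_mem (o t ω).1 (o t ω).2.1 i
  rw [abs_le]
  constructor <;> linarith [h1.1, h1.2, h2.1, h2.2]

variable [IsProbabilityMeasure μ]

/-- Functions of the current context that are centered given the past are orthogonal to it. -/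
theorem integral_mul_eq_zero (hI : IsInteraction P μ T o) {τ : ℕ} (hτ : τ < T)
    {Y : Type*} [MeasurableSpace Y] {g : Ω → ℝ} (hg : Measurable[pastSigma o τ] g) {C : ℝ}
    (hgC : ∀ ω, |g ω| ≤ C) {W : Ω → Y} (hW : Measurable[pastSigma o τ] W) {f : Y × X → ℝ}
    (hf : Measurable f) {D : ℝ} (hD : ∀ q, |f q| ≤ D) (h0 : ∀ y, ∫ x, f (y, x) ∂P.ν = 0) :
    ∫ ω, g ω * f (W ω, (o τ ω).1) ∂μ = 0 := by
  -- Truncation at `C` makes the integrand bounded on the whole product space; it is inactive at the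
  -- values taken by `g`.
  have hF : Measurable fun q : (ℝ × Y) × X =>
      (if |q.1.1| ≤ C then q.1.1 else 0) * f (q.1.2, q.2) := by
    refine Measurable.mul (Measurable.ite ?_ measurable_fst.fst measurable_const)
      (hf.comp (measurable_fst.snd.prodMk measurable_snd))
    exact measurableSet_le (continuous_abs.measurable.comp measurable_fst.fst) measurable_const
  have h1 := integral_eq_integral_integral_of_indep (μ := μ) (pastSigma_le hI.meas τ)
    (hI.meas τ).fst (hI.indep τ hτ) (hg.prodMk hW) hF (C := |C| * D) (fun q => by
      rw [abs_mul]
      refine mul_le_mul ?_ (hD _) (abs_nonneg _) (abs_nonneg _)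
      split_ifs with h
      · exact h.trans (le_abs_self C)
      · rw [abs_zero]; exact abs_nonneg C)
  simp only [if_pos (hgC _), integral_const_mul, hI.law τ hτ, h0, mul_zero, integral_zero] at h1
  exact h1

variable [Fintype A]

/-- The filtration is `playSigma`, since costs are centered only given the context and action too.
The regime indicator is known in advance and is moved into the test function. -/
theorem measure_cost_dev_le [MeasurableSingletonClass A] (hI : IsInteraction P μ T o)
    (E : Estimator X A d) (B : Fin d → ℝ) (b : ℝ) (hT : 1 ≤ T) (hδ : 0 < δ) (hδ1 : δ < 1)
    (k : ℕ) {t : ℕ} (ht : t < T) (i : Fin d) :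
    μ {ω | 2 * regimeUpsilon d T β δ k < ∑ τ ∈ Finset.range (t + 1),
      costIncrement P E T β δ B b i k (fun s => o s ω) τ}
      ≤ ENNReal.ofReal (riskLevel δ k / (2 * (d + 1) * T)) := by
  have hT' : (0 : ℝ) < T := by exact_mod_cast hT
  rw [← exp_neg_log_div (by positivity) (riskLevel_pos hδ k)]
  refine measure_lt_sum_le_exp_neg (playSigma o) playSigma_mono (playSigma_le hI.meas)
    (fun τ ω => costIncrement P E T β δ B b i k (fun s => o s ω) τ) two_pos hT ht ?_ ?_ ?_
    (mul_nonneg zero_le_two (regimeUpsilon_nonneg k)) ?_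
  · intro τ _
    exact measurable_costIncrement (mΩ := playSigma o (τ + 1)) E T β δ B b P i k τ fun s hs =>
      (measurable_pastSigma hs).mono (pastSigma_le_playSigma _) le_rfl
  · intro τ hτ ω
    unfold costIncrement
    split_ifs
    · exact hI.abs_cost_sub_le (by omega) ω i
    · simp
  · rintro τ hτ g hg hg0 ⟨C, hgC⟩
    have hτT : τ < T := by omega
    have hset : MeasurableSet[playSigma o τ]
        {ω | (state E T β δ B b (fun s => o s ω) τ).regime = k} :=
      measurableSet_regime_eq (mΩ := playSigma o τ) E T β δ B b k τ fun s hs =>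
        (measurable_pastSigma hs).mono (pastSigma_le_playSigma _) le_rfl
    have hg' : Measurable[playSigma o τ]
        fun ω => if (state E T β δ B b (fun s => o s ω) τ).regime = k then g ω else 0 :=
      Measurable.ite hset hg measurable_const
    have h1 := integral_mul_sub_condExp_eq_zero (μ := μ) (playSigma_le hI.meas τ)
      (f := fun ω => (o τ ω).2.2.2 i)
      (h := fun ω => P.c (o τ ω).1 (o τ ω).2.1 i) (C := 1) (D := C)
      (measurable_pi_iff.mp (hI.meas τ).snd.snd.snd i)
      ((P.measurable_c i).comp ((hI.meas τ).fst.prodMk (hI.meas τ).snd.fst))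
      (fun ω => abs_le.mpr (hI.cost_mem τ hτT ω i))
      (fun ω => abs_le.mpr (P.c_mem _ _ i))
      (hI.cost_condExp τ hτT i) hg'
      (fun ω => by
        split_ifs
        · rw [abs_of_nonneg (hg0 ω)]; exact hgC ω
        · rw [abs_zero]; exact (hg0 ω).trans (hgC ω))
    refine le_of_eq (Eq.trans ?_ h1)
    refine integral_congr_ae (Filter.Eventually.of_forall fun ω => ?_)
    simp only [costIncrement]
    split_ifs <;> simp
  · have := two_mul_log_le_regimeUpsilon_sq (d := d) (β := β) hT hδ hδ1 k
    nlinarith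

theorem measure_reward_dev_le [MeasurableSingletonClass A] (hI : IsInteraction P μ T o)
    (hT : 1 ≤ T) (hδ : 0 < δ) (hδ1 : δ < 1) (k : ℕ) :
    μ {ω | regimeUpsilon d T β δ k < ∑ τ ∈ Finset.range T,
      (P.r (o τ ω).1 (o τ ω).2.1 - (o τ ω).2.2.1)}
      ≤ ENNReal.ofReal (riskLevel δ k / (2 * (d + 1) * T)) := by
  have hT' : (0 : ℝ) < T := by exact_mod_cast hT
  rw [← exp_neg_log_div (by positivity) (riskLevel_pos hδ k)]
  have hrm : ∀ (m : MeasurableSpace Ω) (τ : ℕ), Measurable[m] (o τ) →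
      Measurable[m] fun ω => P.r (o τ ω).1 (o τ ω).2.1 := fun m τ hm =>
    P.measurable_r.comp ((measurable_fst.comp hm).prodMk
      (measurable_fst.comp (measurable_snd.comp hm)))
  have hom : ∀ (m : MeasurableSpace Ω) (τ : ℕ), Measurable[m] (o τ) →
      Measurable[m] fun ω => (o τ ω).2.2.1 := fun m τ hm =>
    measurable_fst.comp (measurable_snd.comp (measurable_snd.comp hm))
  refine measure_lt_sum_le_exp_neg (playSigma o) playSigma_mono (playSigma_le hI.meas)
    (fun τ ω => P.r (o τ ω).1 (o τ ω).2.1 - (o τ ω).2.2.1) one_pos hT le_rfl ?_ ?_ ?_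
    (regimeUpsilon_nonneg k) ?_
  · intro τ _
    have h1 : Measurable[playSigma o (τ + 1)] (o τ) :=
      (measurable_pastSigma (Nat.lt_succ_self τ)).mono (pastSigma_le_playSigma _) le_rfl
    exact (hrm _ τ h1).sub (hom _ τ h1)
  · intro τ hτ ω
    have h1 := hI.reward_mem τ hτ ω
    have h2 := P.r_mem (o τ ω).1 (o τ ω).2.1
    rw [abs_le]
    constructor <;> linarith [h1.1, h1.2, h2.1, h2.2]
  · rintro τ hτ g hg hg0 ⟨C, hgC⟩
    have h1 := integral_mul_sub_condExp_eq_zero (μ := μ) (playSigma_le hI.meas τ)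
      (f := fun ω => (o τ ω).2.2.1) (h := fun ω => P.r (o τ ω).1 (o τ ω).2.1) (C := 1) (D := C)
      (hom _ τ (hI.meas τ)) (hrm _ τ (hI.meas τ))
      (fun ω => by
        have := hI.reward_mem τ hτ ω
        rw [abs_of_nonneg this.1]; exact this.2)
      (fun ω => by
        have := P.r_mem (o τ ω).1 (o τ ω).2.1
        rw [abs_of_nonneg this.1]; exact this.2)
      (hI.reward_condExp τ hτ) hg
      (fun ω => by rw [abs_of_nonneg (hg0 ω)]; exact hgC ω)
    have h2 : ∫ ω, g ω * (P.r (o τ ω).1 (o τ ω).2.1 - (o τ ω).2.2.1) ∂μ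
        = -∫ ω, g ω * ((o τ ω).2.2.1 - P.r (o τ ω).1 (o τ ω).2.1) ∂μ := by
      rw [← integral_neg]
      exact integral_congr_ae (Filter.Eventually.of_forall fun ω => by ring)
    rw [h2, h1, neg_zero]
  · have := two_mul_log_le_regimeUpsilon_sq (d := d) (β := β) hT hδ hδ1 k
    linarith

variable [Nonempty A]

theorem measure_dual_dev_le (hI : IsInteraction P μ T o) {B : Fin d → ℝ} (hB : ∀ i, |B i| ≤ 1)
    (v : Fin d → ℝ) (hT : 1 ≤ T) (hδ : 0 < δ) (hδ1 : δ < 1) (k : ℕ) :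
    μ {ω | (2 + 4 * √d * norm₂ v) * regimeUpsilon d T β δ k < ∑ τ ∈ Finset.range T,
      (P.dual B v - P.gain B v (o τ ω).1)}
      ≤ ENNReal.ofReal (riskLevel δ k / (2 * (d + 1) * T)) := by
  have := P.prob
  have hT' : (0 : ℝ) < T := by exact_mod_cast hT
  have hn := norm₂_nonneg v
  have hdual : |P.dual B v| ≤ 1 + 2 * √d * norm₂ v := by
    rw [P.dual_eq_integral_gain]
    have h := norm_integral_le_of_norm_le_const (μ := P.ν) (f := P.gain B v)
      (Filter.Eventually.of_forall (P.abs_gain_le hB v))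
    simpa using h
  have hb : ∀ x, |P.dual B v - P.gain B v x| ≤ 2 + 4 * √d * norm₂ v := fun x => by
    have h1 := abs_le.mp hdual
    have h2 := abs_le.mp (P.abs_gain_le hB v x)
    rw [abs_le]
    constructor <;> linarith [h1.1, h1.2, h2.1, h2.2]
  rw [← exp_neg_log_div (by positivity) (riskLevel_pos hδ k)]
  refine measure_lt_sum_le_exp_neg (pastSigma o) pastSigma_mono (pastSigma_le hI.meas)
    (fun τ ω => P.dual B v - P.gain B v (o τ ω).1) (w := 2 + 4 * √d * norm₂ v)
    (by positivity) hT le_rfl ?_ (fun τ _ ω => hb _) ?_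
    (mul_nonneg (by positivity) (regimeUpsilon_nonneg k)) ?_
  · intro τ _
    exact measurable_const.sub ((P.measurable_gain_right B v).comp
      (measurable_fst.comp (measurable_pastSigma (Nat.lt_succ_self τ))))
  · rintro τ hτ g hg hg0 ⟨C, hgC⟩
    refine le_of_eq (hI.integral_mul_eq_zero hτ hg (C := C)
      (fun ω => by rw [abs_of_nonneg (hg0 ω)]; exact hgC ω)
      (W := fun _ => ()) measurable_const
      (f := fun q : Unit × X => P.dual B v - P.gain B v q.2)
      (measurable_const.sub ((P.measurable_gain_right B v).comp measurable_snd))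
      (fun q => hb q.2) fun y => ?_)
    simp only
    rw [integral_sub (integrable_const _) (P.integrable_gain hB v), ← P.dual_eq_integral_gain]
    simp
  · have h1 := two_mul_log_le_regimeUpsilon_sq (d := d) (β := β) hT hδ hδ1 k
    have h2 := mul_le_mul_of_nonneg_left h1 (sq_nonneg (2 + 4 * √d * norm₂ v))
    linarith

/-- The indicator of the ball bounds the increments by `4√d R`, by the Lipschitz estimates.
Conditionally on the past, only the context is random. The factor `3` comes from `2T(4√d R)²L = 32 d
T L R²` and `4 d T L ≤ Υ²`, with `L` the logarithm in `Υ`. -/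
theorem measure_gain_dev_le (hI : IsInteraction P μ T o) (E : Estimator X A d) {B : Fin d → ℝ}
    {b : ℝ} (hB : ∀ i, |shift B b i| ≤ 1) (v : Fin d → ℝ) (hd : 0 < d) (hT : 1 ≤ T) (hδ : 0 < δ)
    (hδ1 : δ < 1) (k : ℕ) {t : ℕ} (ht : t < T) :
    μ {ω | 3 * regimeUpsilon d T β δ k * radius d T β δ (norm₂ v) k
      < ∑ τ ∈ Finset.range (t + 1), gainIncrement P E T β δ B b v k (fun s => o s ω) τ}
      ≤ ENNReal.ofReal (riskLevel δ k / (T : ℝ) ^ 2) := by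
  have := P.prob
  have hT' : (0 : ℝ) < T := by exact_mod_cast hT
  have hq : (1 : ℝ) ≤ √d := Real.one_le_sqrt.mpr (by exact_mod_cast hd)
  set R := radius d T β δ (norm₂ v) k with hRdef
  have hR : 0 < R := by
    have h1 := two_le_stepSize_mul_regimeUpsilon (d := d) (β := β) hd hT hδ hδ1 k
    have h2 := norm₂_nonneg v
    rw [hRdef, radius]
    nlinarith
  have hb : ∀ (l : Fin d → ℝ) (x : X), norm₂ (l - v) ≤ R →
      |P.gain (shift B b) v x - P.gain (shift B b) l x
        - (P.dual (shift B b) v - P.dual (shift B b) l)| ≤ 4 * √d * R := by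
    intro l x hl
    have h1 := abs_le.mp (P.abs_gain_sub_gain_le hB v l x)
    have h2 := abs_le.mp (P.abs_dual_sub_dual_le hB v l)
    rw [norm₂_sub_comm] at hl
    have h3 : 2 * √d * norm₂ (v - l) ≤ 2 * √d * R := by gcongr
    rw [abs_le]
    constructor <;> linarith [h1.1, h1.2, h2.1, h2.2]
  rw [← exp_neg_log_div (by positivity) (riskLevel_pos hδ k)]
  refine measure_lt_sum_le_exp_neg (pastSigma o) pastSigma_mono (pastSigma_le hI.meas)
    (fun τ ω => gainIncrement P E T β δ B b v k (fun s => o s ω) τ) (w := 4 * √d * R)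
    (by positivity) hT ht ?_ ?_ ?_
    (mul_nonneg (mul_nonneg (by norm_num) (regimeUpsilon_nonneg k)) hR.le) ?_
  · intro τ _
    exact measurable_gainIncrement (mΩ := pastSigma o (τ + 1)) E T β δ B b P hB v k τ
      fun s hs => measurable_pastSigma hs
  · intro τ _ ω
    unfold gainIncrement
    split_ifs with h
    · exact hb _ _ h.2
    · rw [abs_zero]; positivity
  · rintro τ hτ g hg hg0 ⟨C, hgC⟩
    have hset : MeasurableSet[pastSigma o τ]
        {ω | (state E T β δ B b (fun s => o s ω) τ).regime = k} :=
      measurableSet_regime_eq (mΩ := pastSigma o τ) E T β δ B b k τ fun s hs =>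
        measurable_pastSigma hs
    have hg' : Measurable[pastSigma o τ]
        fun ω => if (state E T β δ B b (fun s => o s ω) τ).regime = k then g ω else 0 :=
      Measurable.ite hset hg measurable_const
    have hlam : Measurable[pastSigma o τ] fun ω => (state E T β δ B b (fun s => o s ω) τ).lam :=
      (measurable_state (mΩ := pastSigma o τ) E T β δ B b τ
        fun s hs => measurable_pastSigma hs).2.2
    have hint : ∀ l, Integrable
        (fun x => P.gain (shift B b) v x - P.gain (shift B b) l x) P.ν := fun l =>
      (P.integrable_gain hB v).sub (P.integrable_gain hB l)
    -- The regime indicator goes into the test function, whereas the ball indicator stays in `f`,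
    -- which must be bounded for every frozen value of the dual variable.
    have h1 := hI.integral_mul_eq_zero (τ := τ) (by omega) hg' (C := C)
      (fun ω => by
        split_ifs
        · rw [abs_of_nonneg (hg0 ω)]; exact hgC ω
        · rw [abs_zero]; exact (hg0 ω).trans (hgC ω)) hlam
      (f := fun q : (Fin d → ℝ) × X => if norm₂ (q.1 - v) ≤ R then
        P.gain (shift B b) v q.2 - P.gain (shift B b) q.1 q.2
          - (P.dual (shift B b) v - P.dual (shift B b) q.1) else 0)
      (by
        refine Measurable.ite ?_ (Measurable.sub (Measurable.sub ?_ (P.measurable_gain _))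
          (measurable_const.sub ?_)) measurable_const
        · exact measurableSet_le (measurable_norm₂.comp (measurable_fst.sub_const v))
            measurable_const
        · exact (P.measurable_gain_right _ v).comp measurable_snd
        · exact (P.continuous_dual hB).measurable.comp measurable_fst)
      (D := 4 * √d * R) (fun q => by
        split_ifs with h
        · exact hb _ _ h
        · rw [abs_zero]; positivity)
      (fun l => by
        simp only
        split_ifs
        · rw [integral_sub (hint l) (integrable_const _),
            integral_sub (P.integrable_gain hB v) (P.integrable_gain hB l),
            ← P.dual_eq_integral_gain, ← P.dual_eq_integral_gain]
          simp
        · simp)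
    refine le_of_eq (Eq.trans ?_ h1)
    refine integral_congr_ae (Filter.Eventually.of_forall fun ω => ?_)
    simp only [gainIncrement, ← hRdef]
    by_cases h2 : (state E T β δ B b (fun s => o s ω) τ).regime = k <;> simp [h2]
  · have h1 := four_mul_log_le_regimeUpsilon_sq (d := d) (β := β) hT hδ hδ1 k
    have h2 := log_sq_div_riskLevel_ge_one hT hδ hδ1 k
    have h3 : √(d : ℝ) ^ 2 = d := Real.sq_sqrt (Nat.cast_nonneg d)
    set L := Real.log ((T : ℝ) ^ 2 / riskLevel δ k)
    have h4 : 0 ≤ (d : ℝ) * T * L := by positivity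
    have h5 : 32 * ((d : ℝ) * T * L) ≤ 9 * regimeUpsilon d T β δ k ^ 2 := by linarith
    calc 2 * T * (4 * √d * R) ^ 2 * L = R ^ 2 * (32 * (√(d : ℝ) ^ 2 * T * L)) := by ring
      _ ≤ R ^ 2 * (9 * regimeUpsilon d T β δ k ^ 2) := by
          rw [h3]; exact mul_le_mul_of_nonneg_left h5 (sq_nonneg R)
      _ = _ := by ring

end IsInteraction

end Deviations

/-! ### Union bound for the good event -/

section GoodProbability

/-- A union bound over a finite set of events of equal risk. -/
theorem measure_biUnion_le_ofReal {Ω ι : Type*} [MeasurableSpace Ω]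
    {μ : Measure Ω} (s : Finset ι) (S : ι → Set Ω) {p q : ℝ}
    (hp : 0 ≤ p) (h : ∀ i ∈ s, μ (S i) ≤ ENNReal.ofReal p) (hq : s.card * p ≤ q) :
    μ (⋃ i ∈ s, S i) ≤ ENNReal.ofReal q := by
  refine (measure_biUnion_finset_le s S).trans ((Finset.sum_le_sum h).trans ?_)
  rw [← ENNReal.ofReal_sum_of_nonneg fun _ _ => hp]
  refine ENNReal.ofReal_le_ofReal ?_
  simpa using hq

variable {Ω X A : Type*} [mΩ : MeasurableSpace Ω] [MeasurableSpace X] [MeasurableSpace A]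
  [MeasurableSingletonClass A] [Fintype A] [Nonempty A] {d : ℕ}
  {μ : Measure Ω} [IsProbabilityMeasure μ] {P : Problem X A d} {E : Estimator X A d}
  {T : ℕ} {o : ℕ → Ω → Obs X A d} {β : ℝ → ℝ} {Cβ δ : ℝ}

/-- Telescoping, from `1/(k+2)² ≤ 1/(k+1) - 1/(k+2)`. -/
theorem sum_inv_sq_le (N : ℕ) :
    ∑ k ∈ Finset.range N, 1 / ((k : ℝ) + 2) ^ 2 ≤ 1 - 1 / ((N : ℝ) + 1) := by
  induction N with
  | zero => simp
  | succ N ih =>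
    rw [Finset.sum_range_succ]
    have h1 : 1 / ((N : ℝ) + 2) ^ 2 ≤ 1 / ((N : ℝ) + 1) - 1 / ((N : ℝ) + 2) := by
      rw [div_sub_div _ _ (by positivity) (by positivity), div_le_div_iff₀ (by positivity)
        (by positivity)]
      nlinarith [Nat.cast_nonneg (α := ℝ) N]
    have h2 : ((N + 1 : ℕ) : ℝ) + 1 = N + 2 := by push_cast; ring
    rw [h2]
    linarith

theorem sum_riskLevel_le (hδ : 0 < δ) (N : ℕ) :
    ∑ k ∈ Finset.range N, riskLevel δ k ≤ δ / 4 := by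
  have h1 : ∑ k ∈ Finset.range N, riskLevel δ k
      = δ / 4 * ∑ k ∈ Finset.range N, 1 / ((k : ℝ) + 2) ^ 2 := by
    rw [Finset.mul_sum]
    refine Finset.sum_congr rfl fun k _ => ?_
    unfold riskLevel
    field_simp
  have h2 := sum_inv_sq_le N
  have h3 : (0 : ℝ) ≤ 1 / ((N : ℝ) + 1) := by positivity
  rw [h1]
  nlinarith

/-- Each regime costs three times its risk level (accuracy, dual integrand, costs) and these levels
sum to at most `δ/4`; the two remaining events cost at most `δ/16` each, so the total is at most
`7δ/8`. -/
theorem measure_not_good_le (hI : IsInteraction P μ T o)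
    (hE : UniformEstimation P E μ T o β Cβ) {B : Fin d → ℝ} {b : ℝ}
    (hB : ∀ i, |shift B b i| ≤ 1) (v : Fin d → ℝ) (K : ℕ) (hd : 0 < d) (hT : 1 ≤ T)
    (hδ : 0 < δ) (hδ1 : δ < 1) :
    μ {ω | ¬ Good P E T β δ B b v K (fun s => o s ω)} ≤ ENNReal.ofReal δ := by
  have hT' : (1 : ℝ) ≤ T := by exact_mod_cast hT
  have hd' : (0 : ℝ) ≤ d := Nat.cast_nonneg d
  let S₁ : ℕ → Set Ω := fun k =>
    {ω | ¬ ∀ t ≤ T, Accurate P E t (hist (fun s => o s ω) t) (riskLevel δ k)}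
  let S₂ : ℕ → ℕ → Set Ω := fun k t =>
    {ω | 3 * regimeUpsilon d T β δ k * radius d T β δ (norm₂ v) k
      < ∑ τ ∈ Finset.range (t + 1), gainIncrement P E T β δ B b v k (fun s => o s ω) τ}
  let S₃ : ℕ → ℕ × Fin d → Set Ω := fun k q =>
    {ω | 2 * regimeUpsilon d T β δ k
      < ∑ τ ∈ Finset.range (q.1 + 1), costIncrement P E T β δ B b q.2 k (fun s => o s ω) τ}
  let S₄ : Set Ω := {ω | regimeUpsilon d T β δ (ilog T) < ∑ τ ∈ Finset.range T,
      (P.r (o τ ω).1 (o τ ω).2.1 - (o τ ω).2.2.1)}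
  let S₅ : Set Ω := {ω | (2 + 4 * √d * norm₂ v) * regimeUpsilon d T β δ (ilog T)
      < ∑ τ ∈ Finset.range T, (P.dual (shift B b) v - P.gain (shift B b) v (o τ ω).1)}
  have hsub : {ω | ¬ Good P E T β δ B b v K (fun s => o s ω)}
      ⊆ (⋃ k ∈ Finset.range (K + 1), (S₁ k ∪ (⋃ t ∈ Finset.range T, S₂ k t)
        ∪ ⋃ q ∈ Finset.range T ×ˢ Finset.univ, S₃ k q)) ∪ S₄ ∪ S₅ := by
    intro ω hω
    by_contra hcon
    simp only [Set.mem_union, Set.mem_iUnion, Finset.mem_range, Finset.mem_product,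
      Finset.mem_univ, and_true, exists_prop, not_or, not_exists, not_and] at hcon
    obtain ⟨⟨h1, h2⟩, h3⟩ := hcon
    refine hω ⟨fun k hk => ?_, fun k hk t ht => ?_, fun k hk t ht i => ?_, ?_, ?_⟩
    · exact not_not.mp (h1 k (Nat.lt_succ_iff.mpr hk)).1.1
    · exact not_lt.mp ((h1 k (Nat.lt_succ_iff.mpr hk)).1.2 t ht)
    · exact not_lt.mp ((h1 k (Nat.lt_succ_iff.mpr hk)).2 (t, i) ht)
    · exact not_lt.mp h2
    · exact not_lt.mp h3
  have hk : ∀ k, μ (S₁ k ∪ (⋃ t ∈ Finset.range T, S₂ k t)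
      ∪ ⋃ q ∈ Finset.range T ×ˢ Finset.univ, S₃ k q) ≤ ENNReal.ofReal (3 * riskLevel δ k) := by
    intro k
    have hr := riskLevel_pos hδ k
    have h1 : μ (S₁ k) ≤ ENNReal.ofReal (riskLevel δ k) :=
      hE.accurate _ (riskLevel_mem hδ hδ1 k)
    have h2 : μ (⋃ t ∈ Finset.range T, S₂ k t) ≤ ENNReal.ofReal (riskLevel δ k) := by
      refine measure_biUnion_le_ofReal _ _ (p := riskLevel δ k / (T : ℝ) ^ 2) (by positivity)
        (fun t ht => hI.measure_gain_dev_le E hB v hd hT hδ hδ1 k (Finset.mem_range.mp ht)) ?_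
      rw [Finset.card_range, mul_div_assoc', div_le_iff₀ (by positivity)]
      nlinarith [mul_le_mul_of_nonneg_left hT' (show 0 ≤ T * riskLevel δ k by positivity)]
    have h3 : μ (⋃ q ∈ Finset.range T ×ˢ Finset.univ, S₃ k q)
        ≤ ENNReal.ofReal (riskLevel δ k) := by
      refine measure_biUnion_le_ofReal _ _ (p := riskLevel δ k / (2 * (d + 1) * T))
        (by positivity) (fun q hq => hI.measure_cost_dev_le E B b hT hδ hδ1 k
          (Finset.mem_range.mp (Finset.mem_product.mp hq).1) q.2) ?_
      rw [Finset.card_product, Finset.card_range, Finset.card_univ, Fintype.card_fin,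
        mul_div_assoc', div_le_iff₀ (by positivity)]
      push_cast
      nlinarith [show 0 ≤ T * riskLevel δ k by positivity,
        show 0 ≤ d * (T * riskLevel δ k) by positivity]
    calc _ ≤ μ (S₁ k) + μ (⋃ t ∈ Finset.range T, S₂ k t)
            + μ (⋃ q ∈ Finset.range T ×ˢ Finset.univ, S₃ k q) :=
          (measure_union_le _ _).trans (add_le_add_left (measure_union_le _ _) _)
      _ ≤ ENNReal.ofReal (riskLevel δ k) + ENNReal.ofReal (riskLevel δ k)
            + ENNReal.ofReal (riskLevel δ k) := add_le_add (add_le_add h1 h2) h3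
      _ = _ := by
          rw [← ENNReal.ofReal_add hr.le hr.le, ← ENNReal.ofReal_add (by linarith) hr.le]
          ring_nf
  have hlast : riskLevel δ (ilog T) / (2 * (d + 1) * T) ≤ δ / 16 := by
    refine (div_le_self (riskLevel_pos hδ _).le ?_).trans (riskLevel_le hδ _)
    nlinarith [mul_nonneg hd' (by linarith : (0 : ℝ) ≤ T)]
  have h4 : μ S₄ ≤ ENNReal.ofReal (δ / 16) :=
    (hI.measure_reward_dev_le hT hδ hδ1 _).trans (ENNReal.ofReal_le_ofReal hlast)
  have h5 : μ S₅ ≤ ENNReal.ofReal (δ / 16) :=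
    (hI.measure_dual_dev_le hB v hT hδ hδ1 _).trans (ENNReal.ofReal_le_ofReal hlast)
  have h6 : μ (⋃ k ∈ Finset.range (K + 1), (S₁ k ∪ (⋃ t ∈ Finset.range T, S₂ k t)
        ∪ ⋃ q ∈ Finset.range T ×ˢ Finset.univ, S₃ k q)) ≤ ENNReal.ofReal (3 * (δ / 4)) := by
    refine (measure_biUnion_finset_le _ _).trans ((Finset.sum_le_sum fun k _ => hk k).trans ?_)
    rw [← ENNReal.ofReal_sum_of_nonneg fun k _ => by linarith [riskLevel_pos hδ k],
      ← Finset.mul_sum]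
    exact ENNReal.ofReal_le_ofReal
      (mul_le_mul_of_nonneg_left (sum_riskLevel_le hδ _) (by norm_num))
  calc _ ≤ _ := measure_mono hsub
    _ ≤ _ := (measure_union_le _ _).trans (add_le_add_left (measure_union_le _ _) _)
    _ ≤ ENNReal.ofReal (3 * (δ / 4)) + ENNReal.ofReal (δ / 16) + ENNReal.ofReal (δ / 16) :=
        add_le_add (add_le_add h6 h4) h5
    _ ≤ ENNReal.ofReal δ := by
        rw [← ENNReal.ofReal_add (by linarith) (by linarith),
          ← ENNReal.ofReal_add (by linarith) (by linarith)]
        exact ENNReal.ofReal_le_ofReal (by linarith)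

end GoodProbability

/-! ### Rates in `T` and `δ`, and the adapted regime -/

section Rates

variable {d T : ℕ} {β : ℝ → ℝ} {δ Cβ : ℝ}

theorem le_two_pow_ilog (hT : 1 ≤ T) : (T : ℝ) ≤ 2 ^ ilog T := by
  have hT' : (0 : ℝ) < T := by exact_mod_cast hT
  have h1 : Real.logb 2 T ≤ ilog T := Nat.le_ceil _
  rw [← Real.rpow_natCast]
  exact (Real.logb_le_iff_le_rpow one_lt_two hT').mp h1

theorem log_div_nonneg (hT : 1 ≤ T) (hδ : 0 < δ) (hδ1 : δ < 1) : 0 ≤ Real.log (T / δ) := by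
  have hT' : (1 : ℝ) ≤ T := by exact_mod_cast hT
  exact Real.log_nonneg ((one_le_div hδ).mpr (by linarith))

theorem log_le_log_div (hT : 1 ≤ T) (hδ : 0 < δ) (hδ1 : δ < 1) :
    Real.log T ≤ Real.log (T / δ) := by
  have hT' : (1 : ℝ) ≤ T := by exact_mod_cast hT
  refine Real.log_le_log (by linarith) ?_
  rw [le_div_iff₀ hδ]
  nlinarith

theorem ilog_add_one_le (hT : 1 ≤ T) (hδ : 0 < δ) (hδ1 : δ < 1) :
    (ilog T : ℝ) + 1 ≤ 2 * (1 + Real.log (T / δ)) := by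
  have hT' : (1 : ℝ) ≤ T := by exact_mod_cast hT
  have h0 : 0 ≤ Real.log T := Real.log_nonneg hT'
  have h1 : Real.logb 2 T ≤ 2 * Real.log T := by
    rw [Real.logb, div_le_iff₀ (Real.log_pos one_lt_two)]
    nlinarith [Real.log_two_gt_d9]
  have h2 : (ilog T : ℝ) < Real.logb 2 T + 1 :=
    Nat.ceil_lt_add_one (Real.logb_nonneg one_lt_two hT')
  have h3 := log_le_log_div hT hδ hδ1
  linarith

/-- Dividing the risk by `4(ilog T + 2)²` adds only `2 log(2(ilog T + 2))`, and `ilog T` is itself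
of logarithmic order. -/
theorem log_div_riskLevel_le (hT : 1 ≤ T) (hδ : 0 < δ) (hδ1 : δ < 1) :
    Real.log (T / riskLevel δ (ilog T)) ≤ 7 * (1 + Real.log (T / δ)) := by
  have hT' : (0 : ℝ) < T := by exact_mod_cast hT
  have h1 := ilog_add_one_le hT hδ hδ1
  have h2 := log_div_nonneg hT hδ hδ1
  have e : (T : ℝ) / riskLevel δ (ilog T) = T / δ * (2 * ((ilog T : ℝ) + 2)) ^ 2 := by
    unfold riskLevel
    field_simp
    ring
  rw [e, Real.log_mul (by positivity) (by positivity), Real.log_pow,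
    Real.log_mul (by norm_num) (by positivity)]
  have h3 := Real.log_le_sub_one_of_pos (show (0 : ℝ) < (ilog T : ℝ) + 2 by positivity)
  have h4 := Real.log_le_sub_one_of_pos (show (0 : ℝ) < 2 by norm_num)
  push_cast
  linarith

/-- The constant in the bound on `Υ`. -/
def upsilonConst (d : ℕ) (Cβ : ℝ) : ℝ := 7 * |Cβ| + 6 * d + (2 * d + 9)

theorem upsilonConst_nonneg (d : ℕ) (Cβ : ℝ) : 0 ≤ upsilonConst d Cβ := by
  unfold upsilonConst
  positivity

theorem log_sq_div_riskLevel_le (hT : 1 ≤ T) (hδ : 0 < δ) (hδ1 : δ < 1) :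
    Real.log ((T : ℝ) ^ 2 / riskLevel δ (ilog T)) ≤ 8 * (1 + Real.log (T / δ)) := by
  have hT' : (0 : ℝ) < T := by exact_mod_cast hT
  have hr := riskLevel_pos hδ (ilog T)
  rw [sq, mul_div_assoc, Real.log_mul hT'.ne' (by positivity)]
  linarith [log_le_log_div hT hδ hδ1, log_div_riskLevel_le hT hδ hδ1]

theorem regimeUpsilon_ilog_le (hT : 1 ≤ T) (hδ : 0 < δ) (hδ1 : δ < 1)
    (hβ : ∀ δ ∈ Set.Ioc (0 : ℝ) 1, β δ ≤ Cβ * √T * Real.log (T / δ)) :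
    regimeUpsilon d T β δ (ilog T) ≤ upsilonConst d Cβ * (√T * (1 + Real.log (T / δ))) := by
  have hT' : (1 : ℝ) ≤ T := by exact_mod_cast hT
  have hr := riskLevel_mem hδ hδ1 (ilog T)
  have hΛ := log_div_nonneg hT hδ hδ1
  have h1 := log_div_riskLevel_le hT hδ hδ1
  have h2 := log_sq_div_riskLevel_le hT hδ hδ1
  have h3 : Real.log (2 * (d + 1) * T / riskLevel δ (ilog T))
      ≤ (2 * d + 9) * (1 + Real.log (T / δ)) := by
    have h4 := hr.1
    rw [mul_div_assoc, Real.log_mul (by positivity) (by positivity)]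
    have h5 := Real.log_le_sub_one_of_pos (show (0 : ℝ) < 2 * (d + 1) by positivity)
    nlinarith [mul_nonneg (Nat.cast_nonneg (α := ℝ) d) hΛ]
  have h0 : 0 ≤ Real.log (T / riskLevel δ (ilog T)) :=
    Real.log_nonneg ((one_le_div hr.1).mpr (hr.2.trans hT'))
  set Λ := 1 + Real.log (T / δ) with hΛdef
  have hΛ1 : 1 ≤ Λ := by linarith
  have hΛ2 : Λ ≤ Λ ^ 2 := by nlinarith
  have hS : 0 ≤ √(T : ℝ) := Real.sqrt_nonneg _
  have hSS : √(T : ℝ) ^ 2 = T := Real.sq_sqrt (by linarith)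
  have hSΛ : 0 ≤ √T * Λ := by positivity
  have hd0 : (0 : ℝ) ≤ d := Nat.cast_nonneg d
  have hC := abs_nonneg Cβ
  unfold regimeUpsilon Upsilon upsilonConst
  rw [div_sq_div_four_eq_riskLevel]
  refine max_le ?_ (max_le ?_ ?_)
  · calc β (riskLevel δ (ilog T)) ≤ Cβ * √T * Real.log (T / riskLevel δ (ilog T)) := hβ _ hr
      _ ≤ |Cβ| * √T * (7 * Λ) := by gcongr; exact le_abs_self _
      _ = 7 * |Cβ| * (√T * Λ) := by ring
      _ ≤ _ := by gcongr; linarith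
  · have h6 : √(d * T * Real.log ((T : ℝ) ^ 2 / riskLevel δ (ilog T))) ≤ 3 * d * (√T * Λ) := by
      refine Real.sqrt_le_iff.mpr ⟨by positivity, ?_⟩
      have h7 : (d : ℝ) ≤ d ^ 2 := by
        rcases Nat.eq_zero_or_pos d with h | h
        · simp [h]
        · have : (1 : ℝ) ≤ d := by exact_mod_cast h
          nlinarith
      calc d * T * Real.log ((T : ℝ) ^ 2 / riskLevel δ (ilog T)) ≤ d * T * (8 * Λ) := by gcongr
        _ ≤ d ^ 2 * T * (9 * Λ ^ 2) := by
            gcongr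
            norm_num
        _ = (3 * d * (√T * Λ)) ^ 2 := by rw [mul_pow, mul_pow, mul_pow, hSS]; ring
    calc _ ≤ 2 * (3 * d * (√T * Λ)) := by gcongr
      _ = 6 * d * (√T * Λ) := by ring
      _ ≤ _ := by gcongr; linarith
  · have h6 : √(2 * T * Real.log (2 * (d + 1) * T / riskLevel δ (ilog T)))
        ≤ (2 * d + 9) * (√T * Λ) := by
      have h7 := log_div_riskLevel_nonneg (d := d) hT hδ hδ1 (ilog T)
      refine Real.sqrt_le_iff.mpr ⟨by positivity, ?_⟩
      calc 2 * T * Real.log (2 * (d + 1) * T / riskLevel δ (ilog T))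
          ≤ (2 * d + 9) * T * ((2 * d + 9) * Λ) := by
            gcongr
            linarith
        _ ≤ (2 * d + 9) * T * ((2 * d + 9) * Λ ^ 2) := by
            gcongr
        _ = ((2 * d + 9) * (√T * Λ)) ^ 2 := by rw [mul_pow, mul_pow, hSS]; ring
    exact h6.trans (mul_le_mul_of_nonneg_right (by linarith) hSΛ)

/-- The constant in the bound on the margin. -/
def marginConst (d : ℕ) (Cβ : ℝ) : ℝ := 2 * (4 + 20 * √d * upsilonConst d Cβ + 2 * √d)

theorem marginConst_nonneg (d : ℕ) (Cβ : ℝ) : 0 ≤ marginConst d Cβ := by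
  have := upsilonConst_nonneg d Cβ
  unfold marginConst
  positivity

theorem margin_le (hT : 1 ≤ T) (hδ : 0 < δ) (hδ1 : δ < 1)
    (hβ : ∀ δ ∈ Set.Ioc (0 : ℝ) 1, β δ ≤ Cβ * √T * Real.log (T / δ)) :
    margin d T β δ ≤ marginConst d Cβ * (1 + Real.log (T / δ)) ^ 2 / √T := by
  have hT' : (1 : ℝ) ≤ T := by exact_mod_cast hT
  have hU := regimeUpsilon_ilog_le (d := d) hT hδ hδ1 hβ
  have hL := ilog_add_one_le hT hδ hδ1
  have hΛ := log_div_nonneg hT hδ hδ1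
  have hU0 := regimeUpsilon_nonneg (d := d) (T := T) (β := β) (δ := δ) (ilog T)
  have hth : threshold d T β δ (ilog T)
    = 4 * √T + 20 * √d * regimeUpsilon d T β δ (ilog T) := rfl
  set Λ := 1 + Real.log (T / δ)
  have hΛ1 : 1 ≤ Λ := by linarith
  have hS : 1 ≤ √(T : ℝ) := Real.one_le_sqrt.mpr hT'
  have hSS : √(T : ℝ) ^ 2 = T := Real.sq_sqrt (by linarith)
  have hSΛ : 1 ≤ √T * Λ := by nlinarith
  have h1 : threshold d T β δ (ilog T) + 2 * √d
      ≤ (4 + 20 * √d * upsilonConst d Cβ + 2 * √d) * (√T * Λ) := by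
    rw [hth]
    have h2 : 20 * √d * regimeUpsilon d T β δ (ilog T)
        ≤ 20 * √d * (upsilonConst d Cβ * (√T * Λ)) := by gcongr
    have h3 : √T ≤ √T * Λ := le_mul_of_one_le_right (by linarith) hΛ1
    have h4 : √(d : ℝ) ≤ √d * (√T * Λ) := le_mul_of_one_le_right (Real.sqrt_nonneg _) hSΛ
    linarith
  have h0 : 0 ≤ threshold d T β δ (ilog T) + 2 * √d := by rw [hth]; positivity
  unfold margin marginConst
  rw [div_le_div_iff₀ (by linarith) (by linarith)]
  calc (1 + (ilog T : ℝ)) * (threshold d T β δ (ilog T) + 2 * √d) * √T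
      ≤ (2 * Λ) * ((4 + 20 * √d * upsilonConst d Cβ + 2 * √d) * (√T * Λ)) * √T := by
        gcongr
        linarith
    _ = 2 * (4 + 20 * √d * upsilonConst d Cβ + 2 * √d) * Λ ^ 2 * √(T : ℝ) ^ 2 := by ring
    _ = _ := by rw [hSS]

/-- The constant in the bound on the regret. -/
def regretConst (d : ℕ) (Cβ : ℝ) : ℝ :=
  144 * √d * upsilonConst d Cβ ^ 2 + √d * marginConst d Cβ + 12 * upsilonConst d Cβ + 128

theorem regretConst_nonneg (d : ℕ) (Cβ : ℝ) : 0 ≤ regretConst d Cβ := by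
  have := upsilonConst_nonneg d Cβ
  have := marginConst_nonneg d Cβ
  unfold regretConst
  positivity

theorem regretBound_le (hT : 1 ≤ T) (hδ : 0 < δ) (hδ1 : δ < 1)
    (hβ : ∀ δ ∈ Set.Ioc (0 : ℝ) 1, β δ ≤ Cβ * √T * Real.log (T / δ)) {n : ℝ} (hn : 0 ≤ n) :
    regretBound d T β δ n ≤ regretConst d Cβ * (1 + n) * √T * (1 + Real.log (T / δ)) ^ 2 := by
  have hT' : (1 : ℝ) ≤ T := by exact_mod_cast hT
  have hU := regimeUpsilon_ilog_le (d := d) hT hδ hδ1 hβ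
  have hm := margin_le (d := d) hT hδ hδ1 hβ
  have hL := ilog_add_one_le hT hδ hδ1
  have hΛ := log_div_nonneg hT hδ hδ1
  have hlog := log_sq_div_riskLevel_le hT hδ hδ1
  have hU0 := regimeUpsilon_nonneg (d := d) (T := T) (β := β) (δ := δ) (ilog T)
  have hC₁ := upsilonConst_nonneg d Cβ
  have hC₂ := marginConst_nonneg d Cβ
  have e1 : Upsilon d T β (δ / (2 + (ilog T : ℝ)) ^ 2) = regimeUpsilon d T β δ (ilog T) := by
    rw [regimeUpsilon, add_comm (2 : ℝ)]
  have e2 : δ / (4 * (2 + (ilog T : ℝ)) ^ 2) = riskLevel δ (ilog T) := by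
    rw [riskLevel, add_comm (2 : ℝ)]
  unfold regretBound regretConst
  simp only [e1, e2]
  set U := regimeUpsilon d T β δ (ilog T)
  set C₁ := upsilonConst d Cβ
  set C₂ := marginConst d Cβ
  set Λ := 1 + Real.log (T / δ)
  set L : ℝ := (ilog T : ℝ) with hLdef
  have hL0 : 0 ≤ L := Nat.cast_nonneg _
  set S := √(T : ℝ) with hSdef
  have hΛ1 : 1 ≤ Λ := by linarith
  have hS : 1 ≤ S := Real.one_le_sqrt.mpr hT'
  have hSS : S ^ 2 = T := Real.sq_sqrt (by linarith)
  have hmax : max 1 (4 * n) ≤ 4 * (1 + n) := max_le (by linarith) (by linarith)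
  have h1 : 36 * max 1 (4 * n) * √d * (U ^ 2 / S)
      ≤ 144 * √d * C₁ ^ 2 * ((1 + n) * S * Λ ^ 2) := by
    have h2 : U ^ 2 / S ≤ C₁ ^ 2 * (S * Λ ^ 2) := by
      rw [div_le_iff₀ (by linarith)]
      calc U ^ 2 ≤ (C₁ * (S * Λ)) ^ 2 := by gcongr
        _ = _ := by ring
    calc _ ≤ 36 * (4 * (1 + n)) * √d * (C₁ ^ 2 * (S * Λ ^ 2)) := by gcongr
      _ = _ := by ring
  have h2 : n * (T * margin d T β δ * √d + 6 * U * L)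
      ≤ (√d * C₂ + 12 * C₁) * ((1 + n) * S * Λ ^ 2) := by
    have h3 : T * margin d T β δ ≤ C₂ * (S * Λ ^ 2) := by
      calc T * margin d T β δ ≤ T * (C₂ * Λ ^ 2 / S) := by gcongr
        _ = C₂ * (S * Λ ^ 2) := by rw [← hSS]; field_simp
    have h4 : 6 * U * L ≤ 6 * (C₁ * (S * Λ)) * (2 * Λ) := by
      gcongr
      linarith
    have h5 : T * margin d T β δ * √d ≤ C₂ * (S * Λ ^ 2) * √d := by gcongr
    have h6 : T * margin d T β δ * √d + 6 * U * L ≤ (√d * C₂ + 12 * C₁) * (S * Λ ^ 2) := by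
      linarith
    calc n * (T * margin d T β δ * √d + 6 * U * L)
        ≤ n * ((√d * C₂ + 12 * C₁) * (S * Λ ^ 2)) := by gcongr
      _ ≤ (1 + n) * ((√d * C₂ + 12 * C₁) * (S * Λ ^ 2)) := by gcongr; linarith
      _ = _ := by ring
  have h3 : 8 * Real.log ((T : ℝ) ^ 2 / riskLevel δ (ilog T)) * L
      ≤ 128 * ((1 + n) * S * Λ ^ 2) := by
    calc 8 * Real.log ((T : ℝ) ^ 2 / riskLevel δ (ilog T)) * L ≤ 8 * (8 * Λ) * (2 * Λ) := by
          gcongr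
          linarith
      _ = 128 * (1 * 1 * Λ ^ 2) := by ring
      _ ≤ _ := by gcongr; linarith
  linarith

/-- Makes the a priori bound `1/b` on the optimal dual variable at most `T`, so that a regime up to
`ilog T` is adapted to it. -/
theorem inv_le_margin (hT : 1 ≤ T) : 1 / (T : ℝ) ≤ margin d T β δ := by
  have hT' : (1 : ℝ) ≤ T := by exact_mod_cast hT
  have hU0 := regimeUpsilon_nonneg (d := d) (T := T) (β := β) (δ := δ) (ilog T)
  have hth : threshold d T β δ (ilog T)
    = 4 * √T + 20 * √d * regimeUpsilon d T β δ (ilog T) := rfl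
  have hS : 1 ≤ √(T : ℝ) := Real.one_le_sqrt.mpr hT'
  have h1 : 0 ≤ 20 * √d * regimeUpsilon d T β δ (ilog T) := by positivity
  have h2 : 1 ≤ threshold d T β δ (ilog T) + 2 * √d := by
    rw [hth]
    linarith [Real.sqrt_nonneg (d : ℝ)]
  unfold margin
  gcongr
  nlinarith [Nat.cast_nonneg (α := ℝ) (ilog T)]

/-- The first regime whose step size is adapted to a dual variable of norm `n`. -/
theorem exists_adapted_regime {n : ℝ} {L : ℕ} (hn : n ≤ 2 ^ L) :
    ∃ K ≤ L, n ≤ 2 ^ K ∧ (2 : ℝ) ^ (K + 1) - 1 ≤ max 1 (4 * n) := by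
  classical
  have hex : ∃ k : ℕ, n ≤ 2 ^ k := ⟨L, hn⟩
  refine ⟨Nat.find hex, Nat.find_min' hex hn, Nat.find_spec hex, ?_⟩
  rcases hK : Nat.find hex with _ | j
  · exact le_max_of_le_left (by norm_num)
  -- Minimality gives `2 ^ j < n`, hence `2 ^ (j + 2) < 4n`; if the first regime already fits, the
  -- left side is `1`.
  · have h1 := not_le.mp (Nat.find_min hex (m := j) (by omega))
    refine le_max_of_le_right ?_
    rw [pow_succ, pow_succ]
    linarith

end Rates

end CBwK

end

/-! ### Assembly of the theorem -/

theorem theorem1 (d : ℕ) (hd : 0 < d) (Cβ : ℝ) :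
    ∃ (C : ℝ) (p : ℕ), ∀ (Ω X A : Type*) [MeasurableSpace Ω] [MeasurableSpace X]
      [MeasurableSpace A] [MeasurableSingletonClass A] [Fintype A] [Nonempty A]
      (μ : Measure Ω) [IsProbabilityMeasure μ]
      (P : CBwK.Problem X A d) (E : CBwK.Estimator X A d) (o : ℕ → Ω → CBwK.Obs X A d)
      (T : ℕ) (β : ℝ → ℝ) (δ : ℝ) (B : Fin d → ℝ),
      1 ≤ T → 0 < δ → δ < 1 → (∀ i, B i ∈ Set.Icc (0 : ℝ) 1) →
      CBwK.IsInteraction P μ T o →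
      CBwK.UniformEstimation P E μ T o β Cβ →
      (∀ ω, CBwK.FollowsMeta E T β δ B (CBwK.margin d T β δ) (fun t => o t ω)) →
      CBwK.margin d T β δ ≤ C * (1 + Real.log (T / δ)) ^ p / √T ∧
      ((∀ i, 2 * CBwK.margin d T β δ ≤ B i) →
        P.Feasible (CBwK.shift B (2 * CBwK.margin d T β δ)) →
        (∃ lam, P.IsDualOptimal (CBwK.shift B (CBwK.margin d T β δ)) lam) ∧
        ∀ lam, P.IsDualOptimal (CBwK.shift B (CBwK.margin d T β δ)) lam →
          μ {ω | ¬ ((∀ i, ∑ t ∈ Finset.range T, (o t ω).2.2.2 i ≤ T * B i) ∧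
              CBwK.regret P B T (fun t => o t ω)
                ≤ CBwK.regretBound d T β δ (CBwK.norm₂ lam) ∧
              CBwK.regret P B T (fun t => o t ω)
                ≤ C * (1 + CBwK.norm₂ lam) * √T * (1 + Real.log (T / δ)) ^ p)}
            ≤ ENNReal.ofReal δ) := by
  refine ⟨CBwK.marginConst d Cβ + CBwK.regretConst d Cβ, 2, ?_⟩
  intro Ω X A _ _ _ _ _ _ μ _ P E o T β δ B hT hδ hδ1 hB hI hE hF
  have hC₁ := CBwK.marginConst_nonneg d Cβ
  have hC₂ := CBwK.regretConst_nonneg d Cβ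
  refine ⟨(CBwK.margin_le hT hδ hδ1 hE.rate).trans (by gcongr; linarith), fun hBb hfeas => ?_⟩
  have hT' : (0 : ℝ) < T := by exact_mod_cast hT
  have hbT : 1 / (T : ℝ) ≤ CBwK.margin d T β δ := CBwK.inv_le_margin hT
  generalize hb : CBwK.margin d T β δ = b at *
  have hb0 : 0 < b := lt_of_lt_of_le (by positivity) hbT
  have hshift : ∀ i, |CBwK.shift B b i| ≤ 1 := fun i => by
    have h1 := hB i
    have h2 := hBb i
    rw [CBwK.shift, abs_le]
    constructor <;> linarith [h1.1, h1.2]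
  -- The budget `B - 2b` is read as `B - b` with a further slack `b`, the form needed for
  -- coercivity.
  have hfeas' : P.Feasible (CBwK.shift (CBwK.shift B b) b) := by
    have e : CBwK.shift (CBwK.shift B b) b = CBwK.shift B (2 * b) := by
      funext i
      simp only [CBwK.shift]
      ring
    rwa [e]
  have hfeasB : P.Feasible B := by
    obtain ⟨π, hπ, hc⟩ := hfeas
    refine ⟨π, hπ, fun i => (hc i).trans ?_⟩
    simp only [CBwK.shift]
    linarith
  refine ⟨P.exists_isDualOptimal hshift hb0 hfeas', fun lam hlam => ?_⟩
  have hn : CBwK.norm₂ lam ≤ 2 ^ CBwK.ilog T := by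
    refine (P.norm₂_le_of_isDualOptimal hshift hb0 hfeas' hlam).trans
      (le_trans ?_ (CBwK.le_two_pow_ilog hT))
    rw [div_le_iff₀ hb0]
    rwa [div_le_iff₀' hT'] at hbT
  obtain ⟨K, hKL, hnK, hKm⟩ := CBwK.exists_adapted_regime hn
  refine (MeasureTheory.measure_mono fun ω hω => ?_).trans
    (CBwK.measure_not_good_le hI hE hshift lam K hd hT hδ hδ1)
  intro hgood
  refine hω ?_
  have S : CBwK.Setup P E T β δ B b lam K (fun t => o t ω) :=
    { d_pos := hd
      T_pos := hT
      δ_pos := hδ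
      δ_lt := hδ1
      shift_le := hshift
      antitone := hE.antitone
      budget := fun k => hE.budget _ (CBwK.riskLevel_mem hδ hδ1 k)
        (fun t => (o t ω).1) (fun t => (o t ω).2.1)
      follows := hF ω
      optimal := hlam
      K_le := hKL
      norm_le := hnK
      card_le := hKm
      good := hgood }
  have hreg := S.regret_le_regretBound hb.symm hb0.le hfeasB
  refine ⟨S.sum_cost_le (fun t ht i => (hI.cost_mem t ht ω i).2) hb.symm, hreg, ?_⟩
  refine (hreg.trans (CBwK.regretBound_le hT hδ hδ1 hE.rate (CBwK.norm₂_nonneg lam))).trans ?_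
  have hn0 := CBwK.norm₂_nonneg lam
  gcongr
  linarith
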